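/- **Setting.** All Hilbert spaces are finite-dimensional, $\log$ is the natural logarithm. Let $\mathcal Z$ be a finite non-empty alphabet, $n\ge 1$, $\mathcal S=\mathcal Z^n$; for each $z\in\mathcal Z$ let $\rho_z$ be a density matrix on $\mathbb C^d$, and for $s=(z_1,\dots,z_n)\in\mathcal S$ put $\rho_s=\rho_{z_1}\otimes\cdots\otimes\rho_{z_n}$. A quantum learning algorithm is a family $\mathcal A=\{\mathcal N_s\}_{s\in\mathcal S}$ of quantum instruments: for each $s$, completely positive trace non-increasing maps $\mathcal N_{s,w}$ ($w$ in a finite set $\mathcal W$) from matrices on $(\mathbb C^d)^{\otimes n}$ to matrices on an output space $B'$, with $\sum_w\mathcal N_{s,w}$ trace preserving. Its output on $s$ is the state $\mathcal N_s(\rho_s)=\sum_w\mathcal N_{s,w}(\rho_s)\otimes|w\rangle\langle w|$ on $B=B'W$. For $s\in\mathcal S$ let $f(z|s)$ be the number of occurrences of $z$ in $s$; $s,s'$ are $1$-neighbors, $s\overset{1}{\sim}s'$, if $\frac12\sum_z|f(z|s)-f(z|s')|=1$. Assume that $\mathcal A$ is - permutation invariant: $\mathcal N_s(\rho_s)=\mathcal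 N_{s'}(\rho_{s'})$ whenever $f(\cdot|s)=f(\cdot|s')$; - $1$-neighbor $(\varepsilon,\delta)$-DP: $\mathrm{Tr}[\Lambda\mathcal N_s(\rho_s)]\le e^{\varepsilon}\,\mathrm{Tr}[\Lambda\mathcal N_{s'}(\rho_{s'})]+\delta$ for all $s\overset{1}{\sim}s'$ and all $0\preceq\Lambda\preceq\mathbb I$; - support consistent: $\mathrm{supp}\,\mathcal N_s(\rho_s)=\mathrm{supp}\,\mathcal N_{s'}(\rho_{s'})$ for all $s\overset{1}{\sim}s'$. For a probability distribution $P_S$ on $\mathcal S$ let $\sigma^{SB}=\sum_sP_S(s)\,|s\rangle\langle s|\otimes\mathcal N_s(\rho_s)$ and $I[S;B]_\sigma=D(\sigma^{SB}\|\sigma^S\otimes\sigma^B)$, where $D(\rho\|\sigma)=\mathrm{Tr}[\rho(\log\rho-\log\sigma)]$ if $\mathrm{supp}\,\rho\subseteq\mathrm{supp}\,\sigma$ and $+\infty$ otherwise. Put $g_k(\varepsilon,\delta)=\frac{e^{k\varepsilon}-1}{e^{\varepsilon}-1}\,\delta$. **Theorem.** There is a constant $m\in(0,1]$, depending only on $|\mathcal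 Z|$, such that with $$h_{|\mathcal Z|}(\varepsilon,\delta)=\log\frac1{1-g_{n(|\mathcal Z|-1)}(\varepsilon,\delta)}+\frac2m\,g_{n(|\mathcal Z|-1)}(\varepsilon,\delta),$$ which satisfies $h_{|\mathcal Z|}(\varepsilon,0)=0$, the following holds: for all $n\ge1$, all $\varepsilon\in[1/n,1)$ and $\delta\ge0$ with $g_{n(|\mathcal Z|-1)}(\varepsilon,\delta)<1$, all $\mathcal W$, $B'$, $d$, $\{\rho_z\}$, all $\mathcal A$ with the three properties above and all $P_S$, $$I[S;B]_\sigma\le(|\mathcal Z|-1)\log(ne\varepsilon)+h_{|\mathcal Z|}(\varepsilon,\delta).$$ -/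

import Mathlib

open scoped Kronecker ComplexOrder

noncomputable section

namespace QLearn

/-! ### States, supports, relative entropy (finite dimension, natural logarithm) -/

/-- Density matrices on the Hilbert space with orthonormal basis indexed by `a`. -/
def IsDensity {a : Type*} [Fintype a] (ρ : Matrix a a ℂ) : Prop :=
  ρ.PosSemidef ∧ ρ.trace = 1

/-- The support of a state: the span of its eigenvectors with positive eigenvalue. -/
def supp {a : Type*} [Fintype a] (ρ : Matrix a a ℂ) : Submodule ℂ (a → ℂ) :=
  Submodule.span ℂ {v | ∃ t : ℝ, 0 < t ∧ ρ.mulVec v = (t : ℂ) • v}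

/-- Logarithm of a Hermitian matrix through its spectral decomposition, with `log 0 = 0`
on the kernel. -/
def matLog {a : Type*} [Fintype a] [DecidableEq a] (ρ : Matrix a a ℂ) : Matrix a a ℂ :=
  cfc Real.log ρ

open Classical in
/-- Quantum relative entropy `D(ρ‖σ)`: `Tr[ρ (log ρ - log σ)]` if `supp ρ ⊆ supp σ`,
and `+∞` otherwise. -/
def relEntropy {a : Type*} [Fintype a] [DecidableEq a] (ρ σ : Matrix a a ℂ) : EReal :=
  if supp ρ ≤ supp σ then (((ρ * (matLog ρ - matLog σ)).trace.re : ℝ) : EReal) else ⊤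

/-- Marginal on the first factor (the second factor is traced out). -/
def marginalFst {a b : Type*} [Fintype b] (σ : Matrix (a × b) (a × b) ℂ) : Matrix a a ℂ :=
  Matrix.of fun i j => ∑ k, σ (i, k) (j, k)

/-- Marginal on the second factor (the first factor is traced out). -/
def marginalSnd {a b : Type*} [Fintype a] (σ : Matrix (a × b) (a × b) ℂ) : Matrix b b ℂ :=
  Matrix.of fun i j => ∑ k, σ (k, i) (k, j)

/-- Quantum mutual information `I[A;B]_σ = D(σ^{AB} ‖ σ^A ⊗ σ^B)`. -/
def mutualInfo {a b : Type*} [Fintype a] [DecidableEq a] [Fintype b] [DecidableEq b]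
    (σ : Matrix (a × b) (a × b) ℂ) : EReal :=
  relEntropy σ (marginalFst σ ⊗ₖ marginalSnd σ)

/-- The classical-quantum state `∑ₛ P(s) |s⟩⟨s| ⊗ τₛ`. -/
def cqState {S b : Type*} [Fintype S] [DecidableEq S] (P : S → ℝ) (τ : S → Matrix b b ℂ) :
    Matrix (S × b) (S × b) ℂ :=
  ∑ s, (P s : ℂ) • (Matrix.single s s (1 : ℂ) ⊗ₖ τ s)

/-! ### Quantum instruments -/

/-- Complete positivity: for every `k`, the map `id_k ⊗ Φ` sends positive semidefinite matrices
to positive semidefinite matrices. -/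
def IsCompletelyPositive {a b : Type*} (Φ : Matrix a a ℂ →ₗ[ℂ] Matrix b b ℂ) : Prop :=
  ∀ (k : ℕ) (X : Matrix (Fin k × a) (Fin k × a) ℂ), X.PosSemidef →
    (Matrix.of fun p q : Fin k × b =>
      Φ (Matrix.of fun x y : a => X (p.1, x) (q.1, y)) p.2 q.2).PosSemidef

/-- A quantum instrument with classical outcomes `w : W`. -/
structure QInstrument (W a b : Type*) [Fintype W] [Fintype a] [Fintype b] where
  /-- the map applied when the outcome is `w` -/
  map : W → (Matrix a a ℂ →ₗ[ℂ] Matrix b b ℂ)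
  completelyPositive : ∀ w, IsCompletelyPositive (map w)
  traceNonincreasing : ∀ w (X : Matrix a a ℂ), X.PosSemidef →
    (map w X).trace.re ≤ X.trace.re
  tracePreserving : ∀ X : Matrix a a ℂ, (∑ w, map w X).trace = X.trace

/-- The joint quantum-classical output `∑_w 𝓔_w(X) ⊗ |w⟩⟨w|` of an instrument. -/
def QInstrument.apply {W a b : Type*} [Fintype W] [DecidableEq W] [Fintype a] [Fintype b]
    (E : QInstrument W a b) (X : Matrix a a ℂ) : Matrix (b × W) (b × W) ℂ :=
  ∑ w, E.map w X ⊗ₖ Matrix.single w w (1 : ℂ)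

/-! ### Data sequences and learning algorithms -/

/-- Number of appearances of the letter `z` in the sequence `s`. -/
def letterCount {Z : Type*} [DecidableEq Z] {n : ℕ} (s : Fin n → Z) (z : Z) : ℕ :=
  (Finset.univ.filter fun i => s i = z).card

/-- The sequences `s` and `s'` are `k`-neighbors:
`k = (1/2) ∑_z |f(z|s) - f(z|s')|` with `f` the letter counts. -/
def IsNeighbor {Z : Type*} [Fintype Z] [DecidableEq Z] {n : ℕ} (k : ℕ) (s s' : Fin n → Z) :
    Prop :=
  (k : ℝ) = 1 / 2 * ∑ z, |(letterCount s z : ℝ) - (letterCount s' z : ℝ)|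

/-- The product state `ρ_s = ρ_{z₁} ⊗ ⋯ ⊗ ρ_{zₙ}` on `(ℂ^d)^{⊗ n}`, in the product basis. -/
def productState {Z : Type*} {n d : ℕ} (ρ : Z → Matrix (Fin d) (Fin d) ℂ) (s : Fin n → Z) :
    Matrix (Fin n → Fin d) (Fin n → Fin d) ℂ :=
  Matrix.of fun x y => ∏ i, ρ (s i) (x i) (y i)

/-- A quantum learning algorithm: for each training sequence `s ∈ Zⁿ` an instrument from
`(ℂ^d)^{⊗ n}` to the quantum output `B'` with hypotheses `w ∈ W` as classical outcomes. -/
abbrev LearningAlgorithm (Z W B : Type*) [Fintype W] [Fintype B] (n d : ℕ) :=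
  (Fin n → Z) → QInstrument W (Fin n → Fin d) B

/-- The output state `𝓝_s(ρ_s)` on `B' ⊗ W` for the training sequence `s`. -/
def LearningAlgorithm.output {Z W B : Type*} [Fintype W] [DecidableEq W] [Fintype B] {n d : ℕ}
    (A : LearningAlgorithm Z W B n d) (ρ : Z → Matrix (Fin d) (Fin d) ℂ) (s : Fin n → Z) :
    Matrix (B × W) (B × W) ℂ :=
  (A s).apply (productState ρ s)

/-- Sequences of the same type are mapped to the same output state. -/
def IsPermutationInvariant {Z b : Type*} [DecidableEq Z] {n : ℕ}
    (τ : (Fin n → Z) → Matrix b b ℂ) : Prop :=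
  ∀ s s', letterCount s = letterCount s' → τ s = τ s'

/-- `1`-neighbor `(ε, δ)`-differential privacy of the output states `τ_s`. -/
def IsOneNeighborDP {Z b : Type*} [Fintype Z] [DecidableEq Z] [Fintype b] [DecidableEq b] {n : ℕ}
    (τ : (Fin n → Z) → Matrix b b ℂ) (ε δ : ℝ) : Prop :=
  ∀ s s', IsNeighbor 1 s s' → ∀ L : Matrix b b ℂ, L.PosSemidef → (1 - L).PosSemidef →
    (L * τ s).trace.re ≤ Real.exp ε * (L * τ s').trace.re + δ

/-- Support consistency of the output states `τ_s`. -/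
def IsSupportConsistent {Z b : Type*} [Fintype Z] [DecidableEq Z] [Fintype b] {n : ℕ}
    (τ : (Fin n → Z) → Matrix b b ℂ) : Prop :=
  ∀ s s', IsNeighbor 1 s s' → supp (τ s) = supp (τ s')

/-- `g_k(ε, δ) = (e^{kε} - 1) / (e^ε - 1) · δ`. -/
def groupDelta (k ε δ : ℝ) : ℝ :=
  (Real.exp (k * ε) - 1) / (Real.exp ε - 1) * δ

/-- `h_N(ε, δ) = log (1 / (1 - g)) + (2 / m) g` with `g = g_{n(N-1)}(ε, δ)`, where `n` is the
length of the training data, `N` the alphabet size and `m` a constant. -/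
def stabilityCorrection (m : ℝ) (n N : ℕ) (ε δ : ℝ) : ℝ :=
  Real.log (1 / (1 - groupDelta (n * ((N : ℝ) - 1)) ε δ))
    + 2 / m * groupDelta (n * ((N : ℝ) - 1)) ε δ

end QLearn

end

/-! The mutual information of a classical-quantum state is at most the largest relative entropy of
the output states `τ s` to one fixed reference operator of trace at most one, up to a regularisation
that tends to zero (`mutualInfo_cqState_le`). So it suffices to build one reference operator close
to all `τ s`.

For δ = 0, average the output states over a net of types. Privacy along a path of neighbors gives `τ
s ≤ e^{ε k} τ x` for a net point x at distance at most k, so the relative entropy is at most log(net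
size) + ε k. A type has D = |Z| - 1 free coordinates. In a grid of cells of side 2h + 1, with
centers as net points, the product of net size and e^{ε D h} is at most (n ε e^{1 - 1/18})^D for a
suitable h (`exists_radius`), which beats (n e ε)^D with room to spare.

For δ > 0 the domination holds only up to a positive excess operator of trace at most g_k
(`exists_domination`). The excess depends on the state, so the reference operator must cover it too.
A chain of ever finer nets, ending with an exact one, does this: each state is dominated by a sum
with one piece per net (`exists_chain`), and the excesses at the points of net j enter the reference
operator with weight of order θ^j. Small weights are affordable because the excesses have small
trace: lowering the weight of some pieces by a further factor θ costs only (1/θ - 1) times their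
trace, by operator monotonicity of log and Klein's inequality (`trace_mul_matLog_sub_le`,
`relEntropy_chain_le`). As g_k / k increases with k and the radii halve, step j contributes of order
(j + 1) 2^{-j} g, and the total is a constant depending on D times g = g_{nD}. The slack e^{-D/18}
of the first net pays for the mass of the finer ones. -/

namespace QLearn

/-! ### Trace inequalities and matrix logarithms -/

section MatrixBasics

open Matrix
open scoped MatrixOrder Matrix.Norms.L2Operator

variable {a : Type*} [Fintype a]

theorem trace_mul_nonneg {A B : Matrix a a ℂ} (hA : A.PosSemidef) (hB : B.PosSemidef) :
    0 ≤ (A * B).trace.re := by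
  classical
  obtain ⟨C, rfl⟩ := CStarAlgebra.nonneg_iff_eq_star_mul_self.mp hA.nonneg
  rw [star_eq_conjTranspose, Matrix.mul_assoc, Matrix.trace_mul_comm]
  exact (Complex.le_def.mp (hB.mul_mul_conjTranspose_same C).trace_nonneg).1

theorem trace_mul_mono {ρ A B : Matrix a a ℂ} (hρ : ρ.PosSemidef) (hAB : A ≤ B) :
    (ρ * A).trace.re ≤ (ρ * B).trace.re := by
  have := trace_mul_nonneg hρ (Matrix.le_iff.mp hAB)
  rw [Matrix.mul_sub, Matrix.trace_sub, Complex.sub_re] at this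
  linarith

theorem trace_mul_mono_left {ρ A B : Matrix a a ℂ} (hρ : ρ.PosSemidef) (hAB : A ≤ B) :
    (A * ρ).trace.re ≤ (B * ρ).trace.re := by
  rw [Matrix.trace_mul_comm A, Matrix.trace_mul_comm B]
  exact trace_mul_mono hρ hAB

theorem trace_re_mono {A B : Matrix a a ℂ} (hAB : A ≤ B) : A.trace.re ≤ B.trace.re := by
  classical
  simpa using trace_mul_mono (Matrix.PosSemidef.one (n := a) (R := ℂ)) hAB

variable [DecidableEq a]

theorem continuousOn_spectrum (f : ℝ → ℝ) (A : Matrix a a ℂ) :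
    ContinuousOn f (spectrum ℝ A) := by
  rw [continuousOn_iff_continuous_domRestrict]; fun_prop

/-- The weights are the squared overlaps of the two eigenbases. They do not depend on f and g, so
trace inequalities of this shape reduce to scalar ones. -/
theorem exists_weights_trace_cfc_mul_cfc {A B : Matrix a a ℂ} (hA : A.IsHermitian)
    (hB : B.IsHermitian) :
    ∃ w : a → a → ℝ, (∀ i j, 0 ≤ w i j) ∧ ∀ f g : ℝ → ℝ, (cfc f A * cfc g B).trace.re =
      ∑ i, ∑ j, w i j * (f (hA.eigenvalues i) * g (hB.eigenvalues j)) := by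
  set U : Matrix a a ℂ := (hA.eigenvectorUnitary : Matrix a a ℂ)
  set V : Matrix a a ℂ := (hB.eigenvectorUnitary : Matrix a a ℂ)
  refine ⟨fun i j => Complex.normSq ((star U * V) i j), fun i j => Complex.normSq_nonneg _, ?_⟩
  intro f g
  rw [hA.cfc_eq, hB.cfc_eq, Matrix.IsHermitian.cfc, Matrix.IsHermitian.cfc,
    Unitary.conjStarAlgAut_apply, Unitary.conjStarAlgAut_apply]
  have h : (U * diagonal (RCLike.ofReal ∘ f ∘ hA.eigenvalues) * star U *
      (V * diagonal (RCLike.ofReal ∘ g ∘ hB.eigenvalues) * star V)).trace =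
      (diagonal ((RCLike.ofReal : ℝ → ℂ) ∘ f ∘ hA.eigenvalues) * ((star U * V) *
        (diagonal ((RCLike.ofReal : ℝ → ℂ) ∘ g ∘ hB.eigenvalues) * star (star U * V)))).trace := by
    rw [star_mul, star_star]
    simp only [Matrix.mul_assoc]
    rw [Matrix.trace_mul_comm]
    simp only [Matrix.mul_assoc]
  refine (congrArg Complex.re h).trans ?_
  rw [Matrix.trace, Complex.re_sum]
  refine Finset.sum_congr rfl fun i _ => ?_
  rw [Matrix.diag_apply, Matrix.diagonal_mul, Matrix.mul_apply, Finset.mul_sum, Complex.re_sum]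
  refine Finset.sum_congr rfl fun j _ => ?_
  rw [Matrix.diagonal_mul, Matrix.star_apply]
  simp [Complex.normSq_apply]
  ring

/-- Klein's inequality. -/
theorem klein {A B : Matrix a a ℂ} (hA : A.PosSemidef) (hB : B.PosDef) :
    (A.trace - B.trace).re ≤ (A * (matLog A - matLog B)).trace.re := by
  obtain ⟨w, hw, h⟩ := exists_weights_trace_cfc_mul_cfc hA.1 hB.1
  have sA : IsSelfAdjoint A := hA.1
  have sB : IsSelfAdjoint B := hB.1
  have e1 := h (fun x => x) (fun _ => 1)
  have e2 := h (fun _ => 1) (fun x => x)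
  have e3 := h (fun x => x * Real.log x) (fun _ => 1)
  have e4 := h (fun x => x) Real.log
  rw [cfc_mul _ _ A (continuousOn_spectrum _ _) (continuousOn_spectrum _ _)] at e3
  rw [cfc_const_one ℝ B, cfc_id' ℝ A] at e1 e3
  rw [cfc_const_one ℝ A, cfc_id' ℝ B] at e2
  rw [cfc_id' ℝ A] at e4
  rw [Matrix.mul_one] at e1 e3
  rw [Matrix.one_mul] at e2
  rw [Matrix.mul_sub, Matrix.trace_sub, Complex.sub_re, Complex.sub_re, matLog, matLog, e1, e2, e3,
    e4]
  simp only [← Finset.sum_sub_distrib, ← mul_sub]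
  -- What remains is p - q ≤ p (log p - log q) for eigenvalues p ≥ 0 and q > 0.
  refine Finset.sum_le_sum fun i _ => Finset.sum_le_sum fun j _ =>
    mul_le_mul_of_nonneg_left ?_ (hw i j)
  have hp := hA.eigenvalues_nonneg i
  have hq := hB.eigenvalues_pos j
  set p := hA.1.eigenvalues i
  set q := hB.1.eigenvalues j
  rcases hp.eq_or_lt with h0 | h0
  · rw [← h0]; simp; exact hq.le
  · have := Real.log_le_sub_one_of_pos (div_pos hq h0)
    rw [Real.log_div hq.ne' h0.ne'] at this
    have h2 := mul_le_mul_of_nonneg_left this hp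
    have h3 : p * (q / p - 1) = q - p := by field_simp
    rw [h3] at h2
    linarith

theorem matLog_mono {A B : Matrix a a ℂ} (hA : A.PosDef) (h : A ≤ B) : matLog A ≤ matLog B :=
  CFC.log_le_log h hA.isStrictlyPositive

/-- The positive part of a Hermitian matrix. -/
theorem exists_posPart {H : Matrix a a ℂ} (hH : H.IsHermitian) :
    ∃ A L : Matrix a a ℂ, A.PosSemidef ∧ L.PosSemidef ∧ (1 - L).PosSemidef ∧ H ≤ A ∧
      L * H = A := by
  classical
  have sH : IsSelfAdjoint H := hH
  have c := fun f => continuousOn_spectrum f H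
  refine ⟨cfc (fun x : ℝ => max x 0) H, cfc (fun x : ℝ => if 0 < x then 1 else 0) H, ?_, ?_, ?_, ?_, ?_⟩
  · exact (cfc_nonneg (fun x _ => le_max_right _ _)).posSemidef
  · refine (cfc_nonneg (fun x _ => ?_)).posSemidef
    split_ifs <;> norm_num
  · rw [← Matrix.le_iff]
    refine cfc_le_one _ _ (fun x _ => ?_)
    split_ifs <;> norm_num
  · conv_lhs => rw [← cfc_id' ℝ H]
    exact cfc_mono (fun x _ => le_max_left _ _) (c _) (c _)
  · nth_rw 2 [← cfc_id' ℝ H]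
    rw [← cfc_mul _ _ H (c _) (c _)]
    refine cfc_congr fun x _ => ?_
    split_ifs with h
    · rw [one_mul, max_eq_left h.le]
    · rw [zero_mul, max_eq_right (not_lt.mp h)]

/-- Everything lies in the functional calculus of ρ, where log c + log x ≤ log (c x + ζ). The shift
by ζ gives a positive definite argument, as operator monotonicity of log requires. -/
theorem trace_mul_matLog_le {ρ : Matrix a a ℂ} (hρ : ρ.PosSemidef) {c ζ : ℝ} (hc : 0 < c)
    (hζ : 0 < ζ) :
    (ρ * matLog ρ).trace.re ≤
      (ρ * matLog (c • ρ + ζ • (1 : Matrix a a ℂ))).trace.re - Real.log c * ρ.trace.re := by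
  have sρ : IsSelfAdjoint ρ := hρ.1
  have cont := fun f => continuousOn_spectrum f ρ
  have e : c • ρ + ζ • (1 : Matrix a a ℂ) = cfc (fun x : ℝ => c * x + ζ) ρ := by
    rw [cfc_add_const ζ _ ρ (cont _), cfc_const_mul c _ ρ (cont _), cfc_id' ℝ ρ,
      Algebra.algebraMap_eq_smul_one]
  have key : ρ * matLog ρ ≤ ρ * matLog (c • ρ + ζ • (1 : Matrix a a ℂ)) - Real.log c • ρ := by
    have e1 : ρ * matLog ρ = cfc (fun x : ℝ => x * Real.log x) ρ := by
      rw [cfc_mul _ _ ρ (cont _) (cont _), cfc_id' ℝ ρ]; rfl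
    have e2 : ρ * matLog (c • ρ + ζ • (1 : Matrix a a ℂ)) - Real.log c • ρ =
        cfc (fun x : ℝ => x * Real.log (c * x + ζ) - Real.log c * x) ρ := by
      rw [cfc_sub _ _ ρ (cont _) (cont _), cfc_mul _ _ ρ (cont _) (cont _),
        cfc_const_mul _ _ ρ (cont _), cfc_id' ℝ ρ, e, matLog,
        cfc_comp' Real.log _ ρ ((Set.toFinite _).image _ |>.continuousOn _) (cont _)]
    rw [e1, e2]
    refine cfc_mono (fun x hx => ?_) (cont _) (cont _)
    have hx0 : 0 ≤ x := spectrum_nonneg_of_nonneg hρ.nonneg hx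
    rcases hx0.eq_or_lt with h | h
    · simp [← h]
    · have : Real.log c + Real.log x ≤ Real.log (c * x + ζ) := by
        rw [← Real.log_mul hc.ne' h.ne']
        exact Real.log_le_log (by positivity) (by linarith)
      nlinarith
  have := trace_re_mono key
  rw [Matrix.trace_sub, Matrix.trace_smul, Complex.sub_re, Complex.real_smul,
    Complex.re_ofReal_mul] at this
  exact this

/-- Adding mass `Q' - Q` to a reference operator `Q` that dominates `c • ρ` changes the
cross entropy at most by `(Tr Q' - Tr Q) / c`. -/
theorem trace_mul_matLog_sub_le {ρ Q Q' : Matrix a a ℂ} {c : ℝ} (hc : 0 < c)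
    (hQ : Q.PosDef) (hQQ' : Q ≤ Q') (hρQ : c • ρ ≤ Q) :
    (ρ * (matLog Q' - matLog Q)).trace.re ≤ (Q'.trace.re - Q.trace.re) / c := by
  have hQ' : Q'.PosDef := (hQ.isStrictlyPositive.of_le hQQ').posDef
  have hpos : (matLog Q' - matLog Q).PosSemidef := Matrix.le_iff.mp (matLog_mono hQ hQQ')
  have h1 := trace_mul_mono_left hpos hρQ
  have h2 := klein hQ.posSemidef hQ'
  rw [Matrix.smul_mul, Matrix.trace_smul, Complex.real_smul, Complex.re_ofReal_mul] at h1
  rw [← neg_sub (matLog Q'), Matrix.mul_neg, Matrix.trace_neg, Complex.neg_re,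
    Complex.sub_re] at h2
  rw [le_div_iff₀ hc]
  linarith

end MatrixBasics

/-! ### Relative entropy along a chain of operators -/

section ChainEntropy

open Matrix
open scoped MatrixOrder Matrix.Norms.L2Operator

variable {a : Type*}

theorem smul_matrix_mono {A B : Matrix a a ℂ} {c : ℝ} (hc : 0 ≤ c) (h : A ≤ B) :
    c • A ≤ c • B := by
  rw [Matrix.le_iff, ← smul_sub]
  exact (Matrix.le_iff.mp h).smul hc

theorem smul_matrix_mono_left {A : Matrix a a ℂ} {c d : ℝ} (hA : A.PosSemidef) (h : c ≤ d) :
    c • A ≤ d • A := by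
  rw [Matrix.le_iff, ← sub_smul]
  exact hA.smul (sub_nonneg.mpr h)

theorem re_trace_smul [Fintype a] (c : ℝ) (A : Matrix a a ℂ) : (c • A).trace.re = c * A.trace.re := by
  rw [Matrix.trace_smul, Complex.real_smul, Complex.re_ofReal_mul]

theorem re_trace_sum [Fintype a] {ι : Type*} (s : Finset ι) (A : ι → Matrix a a ℂ) :
    (∑ i ∈ s, A i).trace.re = ∑ i ∈ s, (A i).trace.re := by
  rw [Matrix.trace_sum, Complex.re_sum]

theorem posSemidef_finset_sum {ι : Type*} (s : Finset ι) {A : ι → Matrix a a ℂ}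
    (h : ∀ i ∈ s, (A i).PosSemidef) : (∑ i ∈ s, A i).PosSemidef :=
  (Finset.sum_nonneg fun i hi => (h i hi).nonneg).posSemidef

theorem posDef_add_smul_one [DecidableEq a] {A : Matrix a a ℂ} (hA : A.PosSemidef) {ζ : ℝ} (hζ : 0 < ζ) :
    (A + ζ • (1 : Matrix a a ℂ)).PosDef :=
  Matrix.PosDef.posSemidef_add hA (Matrix.PosDef.one.smul hζ)

/-- A state dominated by a chain of positive operators has small relative entropy to any
operator that dominates the chain with geometrically decaying weights. -/
theorem relEntropy_chain_le [Fintype a] [DecidableEq a] {ρ q : Matrix a a ℂ} (hρ : ρ.PosSemidef) (M : ℕ)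
    {X : ℕ → Matrix a a ℂ} (hX : ∀ j, (X j).PosSemidef)
    (hρX : ρ ≤ ∑ j ∈ Finset.range (M + 1), X j) {c θ ζ : ℝ} (hc : 0 < c) (hθ : 0 < θ)
    (hθ1 : θ ≤ 1) (hζ : 0 < ζ)
    (hq : ∑ j ∈ Finset.range (M + 1), (c * θ ^ j) • X j ≤ q) :
    (ρ * (matLog ρ - matLog (q + ζ • (1 : Matrix a a ℂ)))).trace.re ≤
      -Real.log c * ρ.trace.re +
        (1 / θ - 1) * ∑ j ∈ Finset.range (M + 1), (j : ℝ) * (X j).trace.re := by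
  -- The exponent of θ is frozen at i. `Q 0` has uniform weight c and dominates c • ρ + ζ, while `Q
  -- M` carries the final weights and lies below q + ζ.
  set Q : ℕ → Matrix a a ℂ := fun i =>
    ∑ j ∈ Finset.range (M + 1), (c * θ ^ min i j) • X j + ζ • (1 : Matrix a a ℂ) with hQdef
  have hpsd : ∀ i, (∑ j ∈ Finset.range (M + 1), (c * θ ^ min i j) • X j).PosSemidef := fun i =>
    posSemidef_finset_sum _ fun j _ => (hX j).smul (by positivity)
  have hQpd : ∀ i, (Q i).PosDef := fun i => posDef_add_smul_one (hpsd i) hζ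
  have hζ1 : (0 : Matrix a a ℂ) ≤ ζ • (1 : Matrix a a ℂ) :=
    (Matrix.PosSemidef.one.smul hζ.le).nonneg
  have hmono : ∀ i, Q (i + 1) ≤ Q i := by
    intro i
    refine add_le_add_left (Finset.sum_le_sum fun j _ => smul_matrix_mono_left (hX j) ?_) _
    exact mul_le_mul_of_nonneg_left
      (pow_le_pow_of_le_one hθ.le hθ1 (min_le_min_right _ i.le_succ)) hc.le
  have hdom : ∀ i, (c * θ ^ i) • ρ ≤ Q i := by
    intro i
    refine (smul_matrix_mono (by positivity) hρX).trans ?_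
    rw [Finset.smul_sum]
    refine le_add_of_le_of_nonneg (Finset.sum_le_sum fun j _ => smul_matrix_mono_left (hX j) ?_) hζ1
    exact mul_le_mul_of_nonneg_left (pow_le_pow_of_le_one hθ.le hθ1 (min_le_left _ _)) hc.le
  -- From `Q i` to `Q (i + 1)` only the pieces with j > i lose weight, namely c θ^i (1 - θ).
  -- Division by the domination constant c θ^(i+1) leaves 1/θ - 1, free of c and i.
  have hstep : ∀ i, (ρ * (matLog (Q i) - matLog (Q (i + 1)))).trace.re ≤
      (1 / θ - 1) * ∑ j ∈ Finset.range (M + 1), (if i < j then (X j).trace.re else 0) := by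
    intro i
    refine (trace_mul_matLog_sub_le (c := c * θ ^ (i + 1)) (by positivity) (hQpd _) (hmono i)
      (hdom _)).trans_eq ?_
    simp only [hQdef, Matrix.trace_add, Complex.add_re, re_trace_sum, re_trace_smul,
      add_sub_add_right_eq_sub]
    rw [← Finset.sum_sub_distrib, Finset.sum_div, Finset.mul_sum]
    refine Finset.sum_congr rfl fun j _ => ?_
    split_ifs with h
    · rw [min_eq_left h.le, min_eq_left (show i + 1 ≤ j from h)]
      field_simp
      ring
    · have h := not_lt.mp h
      rw [min_eq_right h, min_eq_right (h.trans i.le_succ)]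
      simp
  have htel : (ρ * (matLog (Q 0) - matLog (Q M))).trace.re ≤
      (1 / θ - 1) * ∑ j ∈ Finset.range (M + 1), (j : ℝ) * (X j).trace.re := by
    have e : (ρ * (matLog (Q 0) - matLog (Q M))).trace.re =
        ∑ i ∈ Finset.range M, (ρ * (matLog (Q i) - matLog (Q (i + 1)))).trace.re := by
      rw [← Finset.sum_range_sub' (fun i => matLog (Q i)), Finset.mul_sum, re_trace_sum]
    rw [e]
    refine (Finset.sum_le_sum fun i _ => hstep i).trans_eq ?_
    rw [← Finset.mul_sum, Finset.sum_comm]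
    congr 1
    refine Finset.sum_congr rfl fun j hj => ?_
    rw [← Finset.sum_filter, Finset.sum_const, nsmul_eq_mul]
    congr 2
    have : (Finset.range M).filter (fun i => i < j) = Finset.range j := by
      ext i
      simp only [Finset.mem_filter, Finset.mem_range] at *
      omega
    rw [this, Finset.card_range]
  have hfirst : (ρ * matLog ρ).trace.re ≤
      (ρ * matLog (Q 0)).trace.re - Real.log c * ρ.trace.re := by
    refine (trace_mul_matLog_le hρ hc hζ).trans (sub_le_sub_right (trace_mul_mono hρ
      (matLog_mono (posDef_add_smul_one (hρ.smul hc.le) hζ) ?_)) _)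
    refine add_le_add_left ((smul_matrix_mono hc.le hρX).trans_eq ?_) _
    rw [Finset.smul_sum]
    simp
  have hlast : (ρ * matLog (Q M)).trace.re ≤
      (ρ * matLog (q + ζ • (1 : Matrix a a ℂ))).trace.re := by
    refine trace_mul_mono hρ (matLog_mono (hQpd M) (add_le_add_left (le_trans ?_ hq) _))
    refine (Finset.sum_congr rfl fun j hj => ?_).le
    rw [min_eq_right (by simp at hj; omega)]
  rw [Matrix.mul_sub, Matrix.trace_sub, Complex.sub_re] at htel ⊢
  linarith

end ChainEntropy

/-! ### Functional calculus of block diagonal matrices -/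

section BlockDiagonal

open Matrix Polynomial
open scoped MatrixOrder

variable {S b : Type*} [Fintype S] [DecidableEq S] [Fintype b] [DecidableEq b]

/-- The block diagonal matrix with blocks `M s`, as an algebra homomorphism. -/
def blockHom (S b : Type*) [Fintype S] [DecidableEq S] [Fintype b] [DecidableEq b] :
    (S → Matrix b b ℂ) →ₐ[ℝ] Matrix (S × b) (S × b) ℂ where
  toFun M := Matrix.of fun p q => if p.1 = q.1 then M p.1 p.2 q.2 else 0
  map_one' := by
    ext ⟨s, i⟩ ⟨t, j⟩
    by_cases h : s = t <;> simp [h, Matrix.one_apply]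
  map_mul' M N := by
    ext ⟨s, i⟩ ⟨t, j⟩
    simp only [Matrix.of_apply, Matrix.mul_apply, Fintype.sum_prod_type, Pi.mul_apply]
    rw [Finset.sum_eq_single s]
    · by_cases h : s = t <;> simp [h]
    · intro u _ hu
      simp [hu.symm]
    · simp
  map_zero' := by
    ext ⟨s, i⟩ ⟨t, j⟩
    simp
  map_add' M N := by
    ext ⟨s, i⟩ ⟨t, j⟩
    by_cases h : s = t <;> simp [h]
  commutes' r := by
    ext ⟨s, i⟩ ⟨t, j⟩
    by_cases h : s = t <;> simp [h, Matrix.algebraMap_matrix_apply]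

theorem blockHom_apply (M : S → Matrix b b ℂ) (p q : S × b) :
    blockHom S b M p q = if p.1 = q.1 then M p.1 p.2 q.2 else 0 := rfl

theorem trace_blockHom (M : S → Matrix b b ℂ) :
    (blockHom S b M).trace = ∑ s, (M s).trace := by
  simp [Matrix.trace, Fintype.sum_prod_type, blockHom_apply]

theorem blockHom_mulVec (M : S → Matrix b b ℂ) (u : S × b → ℂ) (s : S) (i : b) :
    (blockHom S b M *ᵥ u) (s, i) = (M s *ᵥ fun j => u (s, j)) i := by
  simp only [Matrix.mulVec, dotProduct, Fintype.sum_prod_type, blockHom_apply]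
  rw [Finset.sum_eq_single s]
  · simp
  · intro t _ ht
    simp [ht.symm]
  · simp

theorem posSemidef_blockHom {M : S → Matrix b b ℂ} (hM : ∀ s, (M s).PosSemidef) :
    (blockHom S b M).PosSemidef := by
  have h : ∀ s, ∃ C : Matrix b b ℂ, M s = Cᴴ * C := fun s =>
    CStarAlgebra.nonneg_iff_eq_star_mul_self.mp (hM s).nonneg
  choose C hC using h
  have e : blockHom S b M = (blockHom S b C)ᴴ * blockHom S b C := by
    have : (blockHom S b C)ᴴ = blockHom S b (fun s => (C s)ᴴ) := by
      ext ⟨s, i⟩ ⟨t, j⟩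
      by_cases h : s = t
      · simp [blockHom_apply, h]
      · simp [blockHom_apply, h, Ne.symm h]
    rw [this, ← map_mul]
    congr 1
    funext s
    exact hC s
  rw [e]
  exact Matrix.posSemidef_conjTranspose_mul_self _

/-- A polynomial interpolating f on the spectra of the whole matrix and of all blocks replaces f,
and algebra homomorphisms commute with polynomials. -/
theorem cfc_blockHom (f : ℝ → ℝ) {M : S → Matrix b b ℂ} (hM : ∀ s, (M s).PosSemidef) :
    cfc f (blockHom S b M) = blockHom S b (fun s => cfc f (M s)) := by
  classical
  let F : Finset ℝ := (Set.toFinite (spectrum ℝ (blockHom S b M))).toFinset ∪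
    Finset.univ.biUnion fun s => (Set.toFinite (spectrum ℝ (M s))).toFinset
  let p : ℝ[X] := Lagrange.interpolate F id f
  have hp : ∀ x ∈ F, f x = p.eval x := fun x hx =>
    (Lagrange.eval_interpolate_at_node f (Function.injective_id.injOn) hx).symm
  have h1 : cfc f (blockHom S b M) = aeval (blockHom S b M) p := by
    rw [← cfc_polynomial p _ (ha := (posSemidef_blockHom hM).1)]
    exact cfc_congr fun x hx => hp x (Finset.mem_union_left _ (by simpa using hx))
  have h2 : ∀ s, cfc f (M s) = aeval (M s) p := by
    intro s
    rw [← cfc_polynomial p _ (ha := (hM s).1)]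
    refine cfc_congr fun x hx => hp x (Finset.mem_union_right _ ?_)
    simp only [Finset.mem_biUnion, Finset.mem_univ, true_and, Set.Finite.mem_toFinset]
    exact ⟨s, hx⟩
  rw [h1, aeval_algHom_apply]
  congr 1
  funext s
  rw [h2]
  exact (aeval_algHom_apply (Pi.evalAlgHom ℝ (fun _ : S => Matrix b b ℂ) s) M p).symm

end BlockDiagonal

/-! ### Kernels and supports -/

section Support

open Matrix
open scoped MatrixOrder

variable {a : Type*} [Fintype a]

theorem mulVec_eq_zero_of_le {T Ω : Matrix a a ℂ} (hT : T.PosSemidef) (h : T ≤ Ω) {u : a → ℂ}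
    (hu : Ω *ᵥ u = 0) : T *ᵥ u = 0 := by
  rw [← hT.dotProduct_mulVec_zero_iff]
  have h1 := (Matrix.le_iff.mp h).dotProduct_mulVec_nonneg u
  rw [Matrix.sub_mulVec, hu, zero_sub, dotProduct_neg] at h1
  exact le_antisymm (neg_nonneg.mp h1) (hT.dotProduct_mulVec_nonneg u)

/-- Expand an eigenvector of T in an eigenbasis of Ω. The basis vectors in the kernel of Ω are
killed by T, hence orthogonal to every eigenvector of T with positive eigenvalue. -/
theorem supp_le_supp [DecidableEq a] {T Ω : Matrix a a ℂ} (hT : T.PosSemidef)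
    (hΩ : Ω.PosSemidef) (h : ∀ u, Ω *ᵥ u = 0 → T *ᵥ u = 0) : supp T ≤ supp Ω := by
  refine Submodule.span_le.mpr ?_
  rintro v ⟨t, ht, hv⟩
  let e := hΩ.1.eigenvectorBasis
  have hsum := e.sum_repr (WithLp.toLp 2 v)
  have hv' : v = ∑ i, e.repr (WithLp.toLp 2 v) i • (e i).ofLp := by
    have := congrArg WithLp.ofLp hsum
    rw [WithLp.ofLp_sum] at this
    exact this.symm
  rw [hv']
  refine Submodule.sum_mem _ fun i _ => ?_
  have hmul : Ω *ᵥ (e i).ofLp = hΩ.1.eigenvalues i • (e i).ofLp :=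
    hΩ.1.mulVec_eigenvectorBasis i
  rcases (hΩ.eigenvalues_nonneg i).eq_or_lt with h0 | h0
  · have hTe : T *ᵥ (e i).ofLp = 0 := h _ (by rw [hmul, ← h0, zero_smul])
    have h1 : star (e i).ofLp ⬝ᵥ (T *ᵥ v) = 0 := by
      rw [Matrix.dotProduct_mulVec, ← hT.1.eq, ← Matrix.star_mulVec, hTe, star_zero,
        zero_dotProduct]
    rw [hv, dotProduct_smul, smul_eq_mul, mul_eq_zero] at h1
    have h2 : star (e i).ofLp ⬝ᵥ v = 0 := h1.resolve_left (by exact_mod_cast ht.ne')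
    have h3 : e.repr (WithLp.toLp 2 v) i = 0 := by
      rw [e.repr_apply_apply, EuclideanSpace.inner_eq_star_dotProduct, dotProduct_comm]
      exact h2
    rw [h3, zero_smul]
    exact Submodule.zero_mem _
  · refine Submodule.smul_mem _ _ (Submodule.subset_span ⟨_, h0, ?_⟩)
    rw [hmul]
    rfl

/-- With log 0 = 0, scaling A by c adds log c only off the kernel of A. The correction involves the
kernel projection K, and T does not see it because c' • T ≤ A. -/
theorem trace_mul_matLog_smul [DecidableEq a] {T A : Matrix a a ℂ} (hT : T.PosSemidef)
    (hA : A.PosSemidef) {c c' : ℝ} (hc : 0 < c) (hc' : 0 < c') (hTA : c' • T ≤ A) :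
    (T * matLog (c • A)).trace.re = Real.log c * T.trace.re + (T * matLog A).trace.re := by
  have sA : IsSelfAdjoint A := hA.1
  have cont := fun f => continuousOn_spectrum f A
  set K : Matrix a a ℂ := cfc (fun x : ℝ => if x = 0 then 1 else 0) A with hK
  have hK0 : K.PosSemidef := (cfc_nonneg fun x _ => by split_ifs <;> norm_num).posSemidef
  have e : matLog (c • A) = Real.log c • (1 - K) + matLog A := by
    have e1 : c • A = cfc (fun x : ℝ => c * x) A := by
      rw [cfc_const_mul c _ A (cont _), cfc_id' ℝ A]
    rw [e1, matLog, ← cfc_comp' Real.log _ A ((Set.toFinite _).image _ |>.continuousOn _) (cont _),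
      matLog, hK, ← cfc_one ℝ A, ← cfc_sub _ _ A (cont _) (cont _), ← cfc_smul _ _ A (cont _),
      ← cfc_add A _ _ (cont _) (cont _)]
    refine cfc_congr fun x _ => ?_
    by_cases hx : x = 0
    · simp [hx]
    · simp [hx, Real.log_mul hc.ne' hx]
  have hAK : A * K = 0 := by
    rw [hK]
    nth_rw 1 [← cfc_id' ℝ A]
    rw [← cfc_mul _ _ A (cont _) (cont _), ← cfc_zero ℝ A]
    exact cfc_congr fun x _ => by by_cases hx : x = 0 <;> simp [hx]
  have h1 := trace_mul_mono_left hK0 hTA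
  rw [hAK, Matrix.smul_mul, re_trace_smul, Matrix.trace_zero, Complex.zero_re] at h1
  have h2 : (T * K).trace.re = 0 := by
    have := trace_mul_nonneg hT hK0
    nlinarith
  rw [e, Matrix.mul_add, Matrix.mul_smul, Matrix.trace_add, Complex.add_re, re_trace_smul,
    Matrix.mul_sub, Matrix.mul_one, Matrix.trace_sub, Complex.sub_re, h2, sub_zero]

end Support

/-! ### Mutual information of classical-quantum states -/

section MutualInfo

open Matrix
open scoped MatrixOrder

variable {S b : Type*} [Fintype S] [DecidableEq S] [Fintype b] [DecidableEq b]

theorem cqState_eq_blockHom (P : S → ℝ) (τ : S → Matrix b b ℂ) :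
    cqState P τ = blockHom S b (fun s => P s • τ s) := by
  ext ⟨s, i⟩ ⟨t, j⟩
  rw [cqState, Matrix.sum_apply, blockHom_apply]
  simp only [Matrix.smul_apply, Matrix.kroneckerMap_apply, Matrix.single_apply, ite_mul, one_mul,
    zero_mul, Complex.real_smul, smul_eq_mul]
  by_cases h : s = t
  · subst h
    simp
  · rw [if_neg h]
    refine Finset.sum_eq_zero fun u _ => ?_
    rw [if_neg (by rintro ⟨rfl, rfl⟩; exact h rfl), mul_zero]

theorem marginalSnd_cqState (P : S → ℝ) (τ : S → Matrix b b ℂ) :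
    marginalSnd (cqState P τ) = ∑ s, P s • τ s := by
  rw [cqState_eq_blockHom]
  ext i j
  simp [marginalSnd, blockHom_apply, Matrix.sum_apply]

theorem marginalFst_cqState (P : S → ℝ) {τ : S → Matrix b b ℂ} (h : ∀ s, (τ s).trace = 1) :
    marginalFst (cqState P τ) = Matrix.diagonal fun s => (P s : ℂ) := by
  rw [cqState_eq_blockHom]
  ext s t
  by_cases hst : s = t
  · subst hst
    have := h s
    simp only [Matrix.trace, Matrix.diag_apply] at this
    simp [marginalFst, blockHom_apply, ← Finset.mul_sum, this]
  · simp [marginalFst, blockHom_apply, hst]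

theorem diagonal_kronecker_eq_blockHom (P : S → ℝ) (A : Matrix b b ℂ) :
    (Matrix.diagonal fun s => (P s : ℂ)) ⊗ₖ A = blockHom S b (fun s => P s • A) := by
  ext ⟨s, i⟩ ⟨t, j⟩
  by_cases h : s = t <;> simp [blockHom_apply, h]

/-- The mutual information of a classical-quantum state is bounded by the largest relative
entropy of its conditional states to a fixed positive definite operator. -/
theorem mutualInfo_cqState_le {P : S → ℝ} (hP : P ∈ stdSimplex ℝ S) {τ : S → Matrix b b ℂ}
    (hτ : ∀ s, IsDensity (τ s)) {Q : Matrix b b ℂ} (hQ : Q.PosDef) {K : ℝ}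
    (hK : ∀ s, (τ s * (matLog (τ s) - matLog Q)).trace.re ≤ K) :
    mutualInfo (cqState P τ) ≤ ((K + (Q.trace.re - 1) : ℝ) : EReal) := by
  obtain ⟨hP0, hP1⟩ := hP
  set σ : Matrix b b ℂ := ∑ s, P s • τ s with hσ
  have hPτ : ∀ s, (P s • τ s).PosSemidef := fun s => (hτ s).1.smul (hP0 s)
  have hσ0 : σ.PosSemidef := posSemidef_finset_sum _ fun s _ => hPτ s
  have hPσ : ∀ s, (P s • σ).PosSemidef := fun s => hσ0.smul (hP0 s)
  have hle : ∀ s, P s • τ s ≤ σ := fun s =>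
    Finset.single_le_sum (f := fun s => P s • τ s) (fun t _ => (hPτ t).nonneg) (Finset.mem_univ s)
  have htr : ∀ s, (τ s).trace.re = 1 := fun s => by rw [(hτ s).2, Complex.one_re]
  have hσtr : σ.trace.re = 1 := by
    rw [hσ, re_trace_sum]
    simp only [re_trace_smul, htr, mul_one]
    exact hP1
  rw [mutualInfo, marginalSnd_cqState, marginalFst_cqState P fun s => (hτ s).2,
    diagonal_kronecker_eq_blockHom, cqState_eq_blockHom, relEntropy, if_pos]
  · rw [EReal.coe_le_coe_iff, matLog, matLog, cfc_blockHom _ hPτ, cfc_blockHom _ hPσ, ← map_sub,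
      ← map_mul, trace_blockHom, Complex.re_sum]
    -- The scalar log (P s) occurs in both logarithms and cancels.
    have hterm : ∀ s, (P s • τ s * (matLog (P s • τ s) - matLog (P s • σ))).trace.re ≤
        P s * K + ((P s • τ s) * (matLog Q - matLog σ)).trace.re := by
      intro s
      rw [Matrix.smul_mul, Matrix.smul_mul, re_trace_smul, re_trace_smul, ← mul_add]
      rcases (hP0 s).eq_or_lt with h | h
      · simp [← h]
      · refine mul_le_mul_of_nonneg_left ?_ h.le
        have h1 := trace_mul_matLog_smul (hτ s).1 (hτ s).1 h one_pos (one_smul ℝ (τ s)).le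
        have h2 := trace_mul_matLog_smul (hτ s).1 hσ0 h h (hle s)
        have h3 := hK s
        rw [Matrix.mul_sub, Matrix.trace_sub, Complex.sub_re] at h3 ⊢
        rw [Matrix.mul_sub, Matrix.trace_sub, Complex.sub_re]
        linarith
    refine (Finset.sum_le_sum fun s _ => hterm s).trans ?_
    rw [Finset.sum_add_distrib, ← Finset.sum_mul, hP1, one_mul, ← re_trace_sum, ← Finset.sum_mul]
    -- After averaging, replacing σ by Q as reference leaves the term Tr σ (log Q - log σ), which is
    -- at most Tr Q - 1.
    have h4 := klein hσ0 hQ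
    rw [← neg_sub (matLog Q), Matrix.mul_neg, Matrix.trace_neg, Complex.neg_re,
      Complex.sub_re] at h4
    linarith
  · refine supp_le_supp (posSemidef_blockHom hPτ) (posSemidef_blockHom hPσ) fun u hu => ?_
    -- The additional factor P s makes the block comparable with P s • σ. It loses nothing, since a
    -- block with P s = 0 vanishes anyway.
    have hT : ∀ s, (P s • (P s • τ s)).PosSemidef := fun s => (hPτ s).smul (hP0 s)
    have h1 : blockHom S b (fun s => P s • (P s • τ s)) *ᵥ u = 0 := by
      refine mulVec_eq_zero_of_le (posSemidef_blockHom hT) ?_ hu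
      rw [Matrix.le_iff, ← map_sub]
      exact posSemidef_blockHom fun s =>
        Matrix.le_iff.mp (smul_matrix_mono (hP0 s) (hle s))
    funext ⟨s, i⟩
    have h2 := congrFun h1 (s, i)
    rw [blockHom_mulVec, Matrix.smul_mulVec, Pi.smul_apply, Pi.zero_apply, smul_eq_zero] at h2
    rw [blockHom_mulVec, Pi.zero_apply]
    rcases h2 with h2 | h2
    · simp [h2]
    · exact h2

end MutualInfo

/-! ### Output states are density matrices -/

section Output

open Matrix
open scoped MatrixOrder

theorem posSemidef_productState {Z : Type*} {n d : ℕ} {ρ : Z → Matrix (Fin d) (Fin d) ℂ}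
    (hρ : ∀ z, (ρ z).PosSemidef) (s : Fin n → Z) : (productState ρ s).PosSemidef := by
  have h : ∀ z, ∃ C : Matrix (Fin d) (Fin d) ℂ, ρ z = Cᴴ * C := fun z =>
    CStarAlgebra.nonneg_iff_eq_star_mul_self.mp (hρ z).nonneg
  choose C hC using h
  have e : productState ρ s = (productState C s)ᴴ * productState C s := by
    ext x y
    simp only [productState, Matrix.of_apply, Matrix.mul_apply, Matrix.conjTranspose_apply]
    simp only [hC, Matrix.mul_apply, Matrix.conjTranspose_apply, star_prod,
      ← Finset.prod_mul_distrib]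
    rw [Finset.prod_univ_sum, Fintype.piFinset_univ]
  rw [e]
  exact Matrix.posSemidef_conjTranspose_mul_self _

theorem trace_productState {Z : Type*} {n d : ℕ} {ρ : Z → Matrix (Fin d) (Fin d) ℂ}
    (hρ : ∀ z, (ρ z).trace = 1) (s : Fin n → Z) : (productState ρ s).trace = 1 := by
  simp only [Matrix.trace, Matrix.diag_apply, productState, Matrix.of_apply] at *
  rw [← Fintype.piFinset_univ]
  exact (Finset.prod_univ_sum (fun _ => Finset.univ) fun i x => ρ (s i) x x).symm.trans
    (Finset.prod_eq_one fun i _ => hρ (s i))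

theorem IsCompletelyPositive.posSemidef {a b : Type*} {Φ : Matrix a a ℂ →ₗ[ℂ] Matrix b b ℂ}
    (hΦ : IsCompletelyPositive Φ) {X : Matrix a a ℂ} (hX : X.PosSemidef) : (Φ X).PosSemidef :=
  (hΦ 1 (X.submatrix Prod.snd Prod.snd) (hX.submatrix _)).submatrix fun y => ((0 : Fin 1), y)

theorem QInstrument.isDensity_apply {W a b : Type*} [Fintype W] [DecidableEq W] [Fintype a]
    [Fintype b] (E : QInstrument W a b) {X : Matrix a a ℂ} (hX : IsDensity X) :
    IsDensity (E.apply X) := by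
  refine ⟨posSemidef_finset_sum _ fun w _ =>
    ((E.completelyPositive w).posSemidef hX.1).kronecker ?_, ?_⟩
  · rw [← Matrix.diagonal_single]
    exact Matrix.PosSemidef.diagonal fun i => by
      by_cases h : i = w
      · subst h; simp
      · simp [h]
  · refine Eq.trans ?_ ((E.tracePreserving X).trans hX.2)
    rw [QInstrument.apply, Matrix.trace_sum, Matrix.trace_sum]
    refine Finset.sum_congr rfl fun w _ => ?_
    rw [Matrix.trace_kronecker, Matrix.trace_single_eq_same, mul_one]

theorem LearningAlgorithm.isDensity_output {Z W B : Type*} [Fintype W] [DecidableEq W]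
    [Fintype B] {n d : ℕ} (A : LearningAlgorithm Z W B n d) {ρ : Z → Matrix (Fin d) (Fin d) ℂ}
    (hρ : ∀ z, IsDensity (ρ z)) (s : Fin n → Z) : IsDensity (A.output ρ s) :=
  (A s).isDensity_apply
    ⟨posSemidef_productState (fun z => (hρ z).1) s, trace_productState (fun z => (hρ z).2) s⟩

end Output

/-! ### Types and their distance -/

section Types

variable {Z : Type*} [Fintype Z] [DecidableEq Z] {n : ℕ}

theorem sum_letterCount (s : Fin n → Z) : ∑ z, letterCount s z = n := by
  simp only [letterCount]
  rw [Finset.sum_card_fiberwise_eq_card_filter]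
  simp

theorem letterCount_le (s : Fin n → Z) (z : Z) : letterCount s z ≤ n :=
  (Finset.single_le_sum (fun _ _ => Nat.zero_le _) (Finset.mem_univ z)).trans_eq
    (sum_letterCount s)

theorem exists_letterCount_eq (g : Z → ℕ) (hg : ∑ z, g z = n) :
    ∃ s : Fin n → Z, letterCount s = g := by
  have e : Fin n ≃ Σ z, Fin (g z) := Fintype.equivOfCardEq (by simp [hg])
  refine ⟨fun i => (e i).1, funext fun z => ?_⟩
  have h : (Finset.univ.filter fun i => (e i).1 = z).card =
      (Finset.univ.map (Function.Embedding.sigmaMk (β := fun z => Fin (g z)) z)).card := by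
    rw [← Finset.card_map e.toEmbedding]
    congr 1
    ext ⟨y, k⟩
    simp only [Finset.mem_map, Finset.mem_filter, Finset.mem_univ, true_and, Equiv.coe_toEmbedding,
      Function.Embedding.sigmaMk_apply]
    constructor
    · rintro ⟨i, rfl, hi⟩
      rw [hi]
      exact ⟨k, rfl⟩
    · rintro ⟨k', hk⟩
      refine ⟨e.symm ⟨y, k⟩, ?_, by simp⟩
      rw [Equiv.apply_symm_apply]
      exact (congrArg Sigma.fst hk).symm
  rw [letterCount, h, Finset.card_map, Finset.card_univ, Fintype.card_fin]

/-- The number of letters that have to be exchanged to turn the type of `s` into that of `s'`. -/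
def typeDist (s s' : Fin n → Z) : ℕ := ∑ z, (letterCount s z - letterCount s' z)

theorem typeDist_comm (s s' : Fin n → Z) : typeDist s s' = typeDist s' s := by
  have h : typeDist s s' + ∑ z, letterCount s' z = typeDist s' s + ∑ z, letterCount s z := by
    simp only [typeDist, ← Finset.sum_add_distrib]
    exact Finset.sum_congr rfl fun z _ => by omega
  simpa only [sum_letterCount, Nat.add_right_cancel_iff] using h

theorem letterCount_eq_of_typeDist_eq_zero {s s' : Fin n → Z} (h : typeDist s s' = 0) :
    letterCount s = letterCount s' := by
  have h' := h
  rw [typeDist_comm] at h'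
  simp only [typeDist, Finset.sum_eq_zero_iff, Finset.mem_univ, true_implies] at h h'
  funext z
  have := h z
  have := h' z
  omega

theorem isNeighbor_of_typeDist {k : ℕ} {s s' : Fin n → Z} (h : typeDist s s' = k) :
    IsNeighbor k s s' := by
  have h' := h
  rw [typeDist_comm] at h'
  have e : ∀ z, |(letterCount s z : ℝ) - (letterCount s' z : ℝ)| =
      ((letterCount s z - letterCount s' z : ℕ) : ℝ) +
        ((letterCount s' z - letterCount s z : ℕ) : ℝ) := by
    intro z
    rcases le_total (letterCount s z) (letterCount s' z) with hz | hz
    · rw [Nat.sub_eq_zero_of_le hz, Nat.cast_sub hz, abs_of_nonpos (by simpa using hz)]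
      simp
    · rw [Nat.sub_eq_zero_of_le hz, Nat.cast_sub hz, abs_of_nonneg (by simpa using hz)]
      simp
  rw [IsNeighbor]
  simp only [e, Finset.sum_add_distrib]
  rw [← Nat.cast_sum, ← Nat.cast_sum]
  rw [typeDist] at h h'
  rw [h, h']
  ring

/-- Both sequences have length n, so there are a letter p in surplus and a letter q in deficit.
Exchanging one p for a q gives the type of t. -/
theorem exists_typeDist_step {k : ℕ} {s s' : Fin n → Z} (h : typeDist s s' = k + 1) :
    ∃ t : Fin n → Z, typeDist s t = 1 ∧ typeDist t s' = k := by
  have h' := h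
  rw [typeDist_comm] at h'
  obtain ⟨p, -, hp⟩ := Finset.exists_ne_zero_of_sum_ne_zero (h.trans_ne k.succ_ne_zero)
  obtain ⟨q, -, hq⟩ := Finset.exists_ne_zero_of_sum_ne_zero (h'.trans_ne k.succ_ne_zero)
  have hpq : q ≠ p := by
    rintro rfl
    omega
  obtain ⟨t, ht⟩ := exists_letterCount_eq (n := n)
    (fun z => if z = p then letterCount s z - 1 else if z = q then letterCount s z + 1
      else letterCount s z) (by
    have e : (∑ z, if z = p then letterCount s z - 1 else if z = q then letterCount s z + 1
        else letterCount s z) + (∑ z, if z = p then 1 else 0) =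
        (∑ z, letterCount s z) + ∑ z, if z = q then 1 else 0 := by
      rw [← Finset.sum_add_distrib, ← Finset.sum_add_distrib]
      refine Finset.sum_congr rfl fun z _ => ?_
      by_cases hzp : z = p
      · subst hzp
        simp only [if_true, if_neg hpq.symm]
        omega
      · by_cases hzq : z = q <;> simp [hzp, hzq, hpq]
    simpa [sum_letterCount] using e)
  refine ⟨t, ?_, ?_⟩
  · rw [typeDist, Finset.sum_eq_single p]
    · simp only [ht, if_true]
      omega
    · intro z _ hz
      simp only [ht, if_neg hz]
      split_ifs <;> omega
    · simp
  · have e : typeDist s s' = typeDist t s' + ∑ z, if z = p then 1 else 0 := by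
      rw [typeDist, typeDist, ← Finset.sum_add_distrib]
      refine Finset.sum_congr rfl fun z _ => ?_
      simp only [ht]
      by_cases hzp : z = p
      · subst hzp
        simp only [if_true]
        omega
      · by_cases hzq : z = q
        · subst hzq
          simp only [if_neg hzp, if_true]
          omega
        · simp [hzp, hzq]
    rw [h] at e
    simpa using e.symm

end Types

/-! ### Group privacy -/

section GroupPrivacy

open Matrix
open scoped MatrixOrder

theorem groupDelta_natCast {ε : ℝ} (hε : 0 < ε) (δ : ℝ) (k : ℕ) :
    groupDelta k ε δ = (∑ i ∈ Finset.range k, Real.exp ε ^ i) * δ := by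
  rw [groupDelta, geom_sum_eq (Real.one_lt_exp_iff.mpr hε).ne', ← Real.exp_nat_mul]

theorem groupDelta_nonneg {ε δ : ℝ} (hε : 0 < ε) (hδ : 0 ≤ δ) (k : ℕ) :
    0 ≤ groupDelta k ε δ := by
  rw [groupDelta_natCast hε]
  positivity

theorem groupDelta_mono {ε δ : ℝ} (hε : 0 < ε) (hδ : 0 ≤ δ) {k K : ℕ} (h : k ≤ K) :
    groupDelta k ε δ ≤ groupDelta K ε δ := by
  rw [groupDelta_natCast hε, groupDelta_natCast hε]
  refine mul_le_mul_of_nonneg_right (Finset.sum_le_sum_of_subset_of_nonneg ?_ ?_) hδ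
  · simpa using h
  · intros
    positivity

/-- `groupDelta k ε δ / k` is the average of the first k terms of an increasing geometric sequence,
hence increasing in k. -/
theorem mul_groupDelta_le {ε δ : ℝ} (hε : 0 < ε) (hδ : 0 ≤ δ) {k K : ℕ} (h : k ≤ K) :
    (K : ℝ) * groupDelta k ε δ ≤ k * groupDelta K ε δ := by
  rw [groupDelta_natCast hε, groupDelta_natCast hε, ← mul_assoc, ← mul_assoc]
  refine mul_le_mul_of_nonneg_right ?_ hδ
  induction K, h using Nat.le_induction with
  | base => exact le_rfl
  | succ K hK ih =>
    rw [Finset.sum_range_succ, mul_add, Nat.cast_succ, add_mul, one_mul]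
    refine add_le_add ih ?_
    calc ∑ i ∈ Finset.range k, Real.exp ε ^ i
        ≤ ∑ _i ∈ Finset.range k, Real.exp ε ^ K := Finset.sum_le_sum fun i hi =>
          pow_le_pow_right₀ (Real.one_le_exp hε.le) (((Finset.mem_range.mp hi).le).trans hK)
      _ = k * Real.exp ε ^ K := by simp

variable {Z b : Type*} [Fintype Z] [DecidableEq Z] [Fintype b] [DecidableEq b] {n : ℕ}
  {τ : (Fin n → Z) → Matrix b b ℂ} {ε δ : ℝ}

/-- Induction along a path of neighboring types. Permutation invariance identifies sequences at
distance zero, and the additive errors build up a geometric sum. -/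
theorem group_privacy (hε : 0 < ε) (hinv : IsPermutationInvariant τ)
    (hdp : IsOneNeighborDP τ ε δ) {L : Matrix b b ℂ} (hL : L.PosSemidef)
    (hL1 : (1 - L).PosSemidef) (k : ℕ) :
    ∀ s s' : Fin n → Z, typeDist s s' = k → (L * τ s).trace.re ≤
      Real.exp (k * ε) * (L * τ s').trace.re + groupDelta k ε δ := by
  induction k with
  | zero =>
    intro s s' h
    rw [hinv s s' (letterCount_eq_of_typeDist_eq_zero h)]
    simp [groupDelta]
  | succ k ih =>
    intro s s' h
    obtain ⟨t, h1, h2⟩ := exists_typeDist_step h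
    have h3 := hdp s t (by simpa using isNeighbor_of_typeDist h1) L hL hL1
    have h4 := mul_le_mul_of_nonneg_left (ih t s' h2) (Real.exp_nonneg ε)
    have e1 : Real.exp ((k + 1 : ℕ) * ε) = Real.exp ε * Real.exp (k * ε) := by
      rw [← Real.exp_add]
      congr 1
      push_cast
      ring
    have e2 : groupDelta (k + 1 : ℕ) ε δ = Real.exp ε * groupDelta k ε δ + δ := by
      rw [groupDelta_natCast hε, groupDelta_natCast hε, geom_sum_succ]
      ring
    rw [e1, e2]
    linarith

/-- A is the positive part of the difference. Its trace is the value of the difference on the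
projection L to the positive eigenspaces, a test to which group privacy applies. -/
theorem exists_domination (hε : 0 < ε) (hδ : 0 ≤ δ) (hτ : ∀ s, (τ s).PosSemidef)
    (hinv : IsPermutationInvariant τ) (hdp : IsOneNeighborDP τ ε δ) {k : ℕ} {s s' : Fin n → Z}
    (h : typeDist s s' ≤ k) :
    ∃ A : Matrix b b ℂ, A.PosSemidef ∧ τ s ≤ Real.exp (k * ε) • τ s' + A ∧
      A.trace.re ≤ groupDelta k ε δ := by
  obtain ⟨A, L, hA, hL, hL1, hle, hLA⟩ := exists_posPart
    (H := τ s - Real.exp (k * ε) • τ s') ((hτ s).1.sub ((hτ s').smul (Real.exp_nonneg _)).1)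
  refine ⟨A, hA, by rwa [sub_le_iff_le_add'] at hle, ?_⟩
  have h1 := group_privacy hε hinv hdp hL hL1 _ s s' rfl
  have h2 := groupDelta_mono hε hδ h
  have h3 : Real.exp (typeDist s s' * ε) * (L * τ s').trace.re ≤
      Real.exp (k * ε) * (L * τ s').trace.re := by
    refine mul_le_mul_of_nonneg_right (Real.exp_le_exp.mpr ?_) (trace_mul_nonneg hL (hτ s'))
    exact mul_le_mul_of_nonneg_right (by exact_mod_cast h) hε.le
  rw [← hLA, Matrix.mul_sub, Matrix.trace_sub, Complex.sub_re, Matrix.mul_smul, re_trace_smul]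
  linarith

end GroupPrivacy

/-! ### Nets in the simplex of types -/

section Nets

variable {Z : Type*} [Fintype Z] [DecidableEq Z] {n : ℕ}

theorem exists_between_sum_eq {ι : Type*} [DecidableEq ι] (s : Finset ι) {u v : ι → ℕ}
    (huv : ∀ i, u i ≤ v i) {m : ℕ} (hu : ∑ i ∈ s, u i ≤ m) (hv : m ≤ ∑ i ∈ s, v i) :
    ∃ c : ι → ℕ, (∀ i, u i ≤ c i) ∧ (∀ i, c i ≤ v i) ∧ ∑ i ∈ s, c i = m := by
  induction m, hu using Nat.le_induction with
  | base => exact ⟨u, fun _ => le_rfl, huv, rfl⟩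
  | succ m _ ih =>
    obtain ⟨c, h1, h2, h3⟩ := ih (by omega)
    obtain ⟨i, hi, hlt⟩ := Finset.exists_lt_of_sum_lt (s := s) (f := c) (g := v) (by omega)
    refine ⟨Function.update c i (c i + 1), fun j => ?_, fun j => ?_, ?_⟩
    · rcases eq_or_ne j i with rfl | hj
      · simpa using (h1 j).trans (Nat.le_succ _)
      · simpa [hj] using h1 j
    · rcases eq_or_ne j i with rfl | hj
      · simpa using hlt
      · simpa [hj] using h2 j
    · rw [Finset.sum_update_of_mem hi, ← h3, ← Finset.add_sum_erase s c hi, Finset.sdiff_singleton_eq_erase]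
      ring

/-- The distance counts surpluses only, and the one at z₀ vanishes. This yields the factor |Z| - 1
without any loss from the coordinate fixed by the total. -/
theorem typeDist_le_of_le {z₀ : Z} {s t : Fin n → Z} {h : ℕ}
    (h0 : letterCount s z₀ ≤ letterCount t z₀)
    (hz : ∀ z ≠ z₀, letterCount s z ≤ letterCount t z + h) :
    typeDist s t ≤ (Fintype.card Z - 1) * h := by
  rw [typeDist, ← Finset.add_sum_erase _ _ (Finset.mem_univ z₀), Nat.sub_eq_zero_of_le h0, zero_add]
  refine (Finset.sum_le_card_nsmul _ _ h fun z hz' => ?_).trans_eq ?_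
  · have := hz z (Finset.ne_of_mem_erase hz')
    omega
  · rw [Finset.card_erase_of_mem (Finset.mem_univ _), Finset.card_univ, smul_eq_mul]

theorem typeDist_le_of_close {z₀ : Z} {s t : Fin n → Z} {h : ℕ}
    (h1 : ∀ z ≠ z₀, letterCount s z ≤ letterCount t z + h)
    (h2 : ∀ z ≠ z₀, letterCount t z ≤ letterCount s z + h) :
    typeDist s t ≤ (Fintype.card Z - 1) * h := by
  rcases le_total (letterCount s z₀) (letterCount t z₀) with h0 | h0
  · exact typeDist_le_of_le h0 h1
  · rw [typeDist_comm]
    exact typeDist_le_of_le h0 h2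

/-- Nets of types obtained by choosing one representative in every cell of a cubic grid. -/
theorem exists_net_of_cells (z₀ : Z) (l K : ℕ)
    (hcell : ∀ s : Fin n → Z, ∃ t : Fin n → Z, ∀ s' : Fin n → Z,
      (∀ z ≠ z₀, letterCount s' z / l = letterCount s z / l) → typeDist s' t ≤ K) :
    ∃ r : (Fin n → Z) → (Fin n → Z), (∀ s, typeDist s (r s) ≤ K) ∧
      (Finset.univ.image r).card ≤ (n / l + 1) ^ (Fintype.card Z - 1) := by
  classical
  let cell : (Fin n → Z) → ({z // z ≠ z₀} → Fin (n / l + 1)) := fun s z =>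
    ⟨letterCount s z / l, Nat.lt_succ_of_le (Nat.div_le_div_right (letterCount_le s z))⟩
  have h : ∀ c : {z // z ≠ z₀} → Fin (n / l + 1), ∃ t : Fin n → Z, ∀ s, cell s = c →
      typeDist s t ≤ K := by
    intro c
    by_cases hc : ∃ s, cell s = c
    · obtain ⟨s, rfl⟩ := hc
      obtain ⟨t, ht⟩ := hcell s
      exact ⟨t, fun s' hs' => ht s' fun z hz => congrArg Fin.val (congrFun hs' ⟨z, hz⟩)⟩
    · exact ⟨fun _ => z₀, fun s hs => (hc ⟨s, hs⟩).elim⟩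
  choose rep hrep using h
  refine ⟨fun s => rep (cell s), fun s => hrep _ s rfl, ?_⟩
  calc (Finset.univ.image fun s => rep (cell s)).card
      ≤ (Finset.univ.image rep).card := Finset.card_le_card fun x hx => by
        obtain ⟨s, -, rfl⟩ := Finset.mem_image.mp hx
        exact Finset.mem_image_of_mem _ (Finset.mem_univ _)
    _ ≤ Fintype.card ({z // z ≠ z₀} → Fin (n / l + 1)) := Finset.card_image_le
    _ = (n / l + 1) ^ (Fintype.card Z - 1) := by
        rw [Fintype.card_fun, Fintype.card_fin, Fintype.card_subtype_compl, Fintype.card_subtype_eq]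

/-- Any type in a cell of side l + 1 represents it. For l = 0 the net is exact. -/
theorem exists_net (z₀ : Z) (l : ℕ) :
    ∃ r : (Fin n → Z) → (Fin n → Z), (∀ s, typeDist s (r s) ≤ (Fintype.card Z - 1) * l) ∧
      (Finset.univ.image r).card ≤ (n / (l + 1) + 1) ^ (Fintype.card Z - 1) := by
  refine exists_net_of_cells z₀ (l + 1) _ fun s => ⟨s, fun s' h => ?_⟩
  have key : ∀ x y : ℕ, x / (l + 1) = y / (l + 1) → x ≤ y + l := by
    intro x y hxy
    have h1 := Nat.div_add_mod x (l + 1)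
    have h2 := Nat.div_add_mod y (l + 1)
    have h3 : x % (l + 1) < l + 1 := Nat.mod_lt x l.succ_pos
    rw [hxy] at h1
    omega
  exact typeDist_le_of_close (fun z hz => key _ _ (h z hz)) fun z hz => key _ _ (h z hz).symm

/-- Nets of types obtained by choosing the center of every cell of a cubic grid, moved into the
simplex of types if necessary. -/
theorem exists_centered_net (z₀ : Z) (h : ℕ) :
    ∃ r : (Fin n → Z) → (Fin n → Z), (∀ s, typeDist s (r s) ≤ (Fintype.card Z - 1) * h) ∧
      (Finset.univ.image r).card ≤ (n / (2 * h + 1) + 1) ^ (Fintype.card Z - 1) := by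
  refine exists_net_of_cells z₀ (2 * h + 1) _ fun s => ?_
  set u : Z → ℕ := fun z => (2 * h + 1) * (letterCount s z / (2 * h + 1)) with hu
  have hus : ∑ z ∈ Finset.univ.erase z₀, u z ≤ n := by
    refine (Finset.sum_le_sum fun z _ => Nat.mul_div_le _ _).trans
      ((Finset.sum_le_sum_of_subset (Finset.erase_subset _ _)).trans_eq (sum_letterCount s))
  have hcell : ∀ s' : Fin n → Z,
      (∀ z ≠ z₀, letterCount s' z / (2 * h + 1) = letterCount s z / (2 * h + 1)) →
      ∀ z ≠ z₀, u z ≤ letterCount s' z ∧ letterCount s' z ≤ u z + 2 * h := by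
    intro s' hs' z hz
    have h1 := Nat.div_add_mod (letterCount s' z) (2 * h + 1)
    have h2 : letterCount s' z % (2 * h + 1) < 2 * h + 1 := Nat.mod_lt _ (2 * h).succ_pos
    rw [hs' z hz] at h1
    simp only [hu]
    omega
  have hrep : ∃ c : Z → ℕ, (∀ z, u z ≤ c z) ∧ (∀ z, c z ≤ u z + h) ∧
      ∑ z ∈ Finset.univ.erase z₀, c z ≤ n ∧
      ((∀ z, c z = u z + h) ∨ ∑ z ∈ Finset.univ.erase z₀, c z = n) := by
    rcases le_total (∑ z ∈ Finset.univ.erase z₀, (u z + h)) n with hle | hle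
    · exact ⟨fun z => u z + h, fun z => Nat.le_add_right _ _, fun z => le_rfl, hle,
        Or.inl fun z => rfl⟩
    · obtain ⟨c, h1, h2, h3⟩ := exists_between_sum_eq _ (fun z => Nat.le_add_right (u z) h) hus hle
      exact ⟨c, h1, h2, h3.le, Or.inr h3⟩
  obtain ⟨c, hc1, hc2, hcn, hc⟩ := hrep
  obtain ⟨t, ht⟩ := exists_letterCount_eq (n := n)
    (Function.update c z₀ (n - ∑ z ∈ Finset.univ.erase z₀, c z)) (by
      rw [Finset.sum_update_of_mem (Finset.mem_univ _), Finset.sdiff_singleton_eq_erase]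
      omega)
  have htz : ∀ z ≠ z₀, letterCount t z = c z := fun z hz => by
    rw [ht, Function.update_of_ne hz]
  refine ⟨t, fun s' hs' => ?_⟩
  rcases hc with hc | hc
  · refine typeDist_le_of_close (z₀ := z₀) (fun z hz => ?_) fun z hz => ?_ <;>
    · have h1 := hcell s' hs' z hz
      rw [htz z hz, hc z]
      omega
  -- The center left the simplex and was lowered to total n. The representative has no letter z₀
  -- then, so only its surpluses elsewhere count, each at most h.
  · rw [typeDist_comm]
    refine typeDist_le_of_le (z₀ := z₀) ?_ fun z hz => ?_
    · rw [ht, Function.update_self, hc, Nat.sub_self]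
      exact Nat.zero_le _
    · have h1 := hcell s' hs' z hz
      have h2 := hc2 z
      rw [htz z hz]
      omega

end Nets

/-! ### Radius of the coarsest net -/

section Radius

/-- This is the cost per coordinate of the centered net: number of cells times e^{ε h}. The slack
1/18 is what both cases leave at their common threshold n ε = 9/4, where 3/2 = (1 - 4/9) + 17/18 and
1/2 + 4/9 = 17/18. -/
theorem exists_radius {n : ℕ} {ε : ℝ} (hn : 1 ≤ n) (h1 : 1 / (n : ℝ) ≤ ε) (h2 : ε < 1) :
    ∃ h : ℕ, h ≤ n ∧ ((n / (2 * h + 1) + 1 : ℕ) : ℝ) * Real.exp (ε * h) ≤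
      n * ε * Real.exp (1 - 1 / 18) := by
  have hn0 : (0 : ℝ) < n := by exact_mod_cast hn
  have hε : 0 < ε := (by positivity : (0 : ℝ) < 1 / n).trans_le h1
  have hR : 1 ≤ n * ε := by
    rw [div_le_iff₀ hn0] at h1
    linarith
  -- The bound (n + 1) / 2 ≤ 2 n / 3 below, with integer division on the left, fails for n = 1.
  have hn2 : 2 ≤ n := by
    by_contra hlt
    have : n = 1 := by omega
    subst this
    norm_num at h1
    linarith
  set R := n * ε with hRdef
  have hR0 : 0 < R := by linarith
  rcases le_total R (9 / 4) with hle | hle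
  -- For small n ε a single cell covers all types.
  · refine ⟨(n + 1) / 2, by omega, ?_⟩
    have e : n / (2 * ((n + 1) / 2) + 1) = 0 := Nat.div_eq_of_lt (by omega)
    rw [e, zero_add, Nat.cast_one, one_mul]
    have h3 : (((n + 1) / 2 : ℕ) : ℝ) ≤ 2 * n / 3 := by
      have : 3 * ((n + 1) / 2) ≤ 2 * n := by omega
      have : (3 : ℝ) * (((n + 1) / 2 : ℕ) : ℝ) ≤ 2 * n := by exact_mod_cast this
      linarith
    have h4 : ε * (((n + 1) / 2 : ℕ) : ℝ) ≤ 2 / 3 * R := by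
      have := mul_le_mul_of_nonneg_left h3 hε.le
      rw [hRdef]
      linarith
    have h5 : 2 / 3 * R ≤ Real.log R + (1 - 1 / 18) := by
      have h6 := Real.one_sub_inv_le_log_of_pos hR0
      have h7 : R * R⁻¹ = 1 := mul_inv_cancel₀ hR0.ne'
      have h8 : R⁻¹ ≤ 1 := inv_le_one_of_one_le₀ hR
      have h9 : 4 / 9 ≤ R⁻¹ := by
        rw [show (4 / 9 : ℝ) = (9 / 4)⁻¹ by norm_num]
        exact inv_anti₀ hR0 hle
      nlinarith [mul_nonneg (sub_nonneg.mpr h8) (sub_nonneg.mpr hle)]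
    calc Real.exp (ε * (((n + 1) / 2 : ℕ) : ℝ)) ≤ Real.exp (Real.log R + (1 - 1 / 18)) :=
          Real.exp_le_exp.mpr (h4.trans h5)
      _ = R * Real.exp (1 - 1 / 18) := by rw [Real.exp_add, Real.exp_log hR0]
  · have hfl : ((⌊1 / ε⌋₊ : ℕ) : ℝ) ≤ 1 / ε := Nat.floor_le (by positivity)
    have hfl' : 1 / ε < (⌊1 / ε⌋₊ : ℕ) + 1 := Nat.lt_floor_add_one _
    set h := ⌊1 / ε⌋₊ with hh
    refine ⟨h, ?_, ?_⟩
    · have : (h : ℝ) ≤ n := by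
        refine hfl.trans ?_
        rw [div_le_iff₀ hε]
        exact hR
      exact_mod_cast this
    · set x := ε * h with hx
      have hx0 : 0 ≤ x := by positivity
      have hx1 : x ≤ 1 := by
        rw [le_div_iff₀ hε] at hfl
        linarith
      have hx2 : 1 < x + ε := by
        rw [div_lt_iff₀ hε] at hfl'
        linarith
      -- The cell side satisfies ε (2 h + 1) = 2 x + ε ≥ 1 + x, and the summand 1 is at most 4/9 of
      -- R.
      have hJ : ((n / (2 * h + 1) + 1 : ℕ) : ℝ) ≤ R * (1 / (1 + x) + 4 / 9) := by
        have h3 : ((n / (2 * h + 1) : ℕ) : ℝ) ≤ n / (2 * h + 1 : ℝ) := by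
          exact_mod_cast Nat.cast_div_le (α := ℝ) (m := n) (n := 2 * h + 1)
        have h4 : (n : ℝ) / (2 * h + 1 : ℝ) ≤ R * (1 / (1 + x)) := by
          rw [mul_one_div, div_le_div_iff₀ (by positivity) (by positivity), hRdef]
          have : 1 + x ≤ ε * (2 * h + 1) := by
            rw [mul_add, mul_left_comm, ← hx]
            linarith
          have := mul_le_mul_of_nonneg_left this hn0.le
          linarith
        push_cast
        linarith
      have h5 : 1 / (1 + x) + 4 / 9 ≤ 17 / 18 * (2 - x) := by
        rw [← sub_nonneg]
        have : 17 / 18 * (2 - x) - (1 / (1 + x) + 4 / 9) =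
            (1 - x) * (8 + 17 * x) / (18 * (1 + x)) := by
          field_simp
          ring
        rw [this]
        have : 0 ≤ 1 - x := by linarith
        positivity
      have h6 : 17 / 18 ≤ Real.exp (-(1 / 18)) := by
        have := Real.add_one_le_exp (-(1 / 18) : ℝ)
        linarith
      have h7 : 2 - x ≤ Real.exp (1 - x) := by
        have := Real.add_one_le_exp (1 - x)
        linarith
      have h8 : 17 / 18 * (2 - x) ≤ Real.exp (-(1 / 18)) * Real.exp (1 - x) :=
        mul_le_mul h6 h7 (by linarith) (Real.exp_nonneg _)
      calc ((n / (2 * h + 1) + 1 : ℕ) : ℝ) * Real.exp x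
          ≤ (R * (Real.exp (-(1 / 18)) * Real.exp (1 - x))) * Real.exp x := by
            refine mul_le_mul_of_nonneg_right (hJ.trans ?_) (Real.exp_nonneg _)
            exact mul_le_mul_of_nonneg_left (h5.trans h8) hR0.le
        _ = R * Real.exp (1 - 1 / 18) := by
            rw [mul_assoc, ← Real.exp_add, ← Real.exp_add]
            congr 2
            ring

end Radius

/-! ### Chains of nets and the reference operator -/

section Multiscale

open Matrix
open scoped MatrixOrder

variable {Z b : Type*} [Fintype b] {n : ℕ} {τ : (Fin n → Z) → Matrix b b ℂ} {ε δ : ℝ}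

/-- Following a chain of nets from fine to coarse, every state of the finest net is dominated by
a sum with one summand for each net. -/
theorem exists_chain {r : ℕ → (Fin n → Z) → (Fin n → Z)} {k : ℕ → ℕ}
    {A : ℕ → (Fin n → Z) → Matrix b b ℂ} {base : ℕ → Matrix b b ℂ} {e : ℕ → ℝ}
    (hτ : ∀ s, (τ s).PosSemidef) (hA : ∀ j s, (A j s).PosSemidef)
    (hdom : ∀ j s, τ s ≤ Real.exp (k j * ε) • τ (r j s) + A j s)
    (htr : ∀ j s, (A j s).trace.re ≤ e j)
    (hbase0 : ∀ s, τ (r 0 s) ≤ base 0) (hbase : ∀ j s, A j (r (j + 1) s) ≤ base (j + 1))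
    (M : ℕ) :
    ∀ s, ∃ X : ℕ → Matrix b b ℂ, (∀ j, (X j).PosSemidef) ∧
      τ (r M s) ≤ ∑ j ∈ Finset.range (M + 1), X j ∧
      (∀ j ≤ M, X j ≤ Real.exp (ε * ∑ i ∈ Finset.Ico j M, (k i : ℝ)) • base j) ∧
      ∀ j < M, (X (j + 1)).trace.re ≤
        Real.exp (ε * ∑ i ∈ Finset.Ico (j + 1) M, (k i : ℝ)) * e j := by
  induction M with
  | zero =>
    intro s
    refine ⟨fun _ => τ (r 0 s), fun _ => hτ _, by simp, fun j hj => ?_, fun j hj => by omega⟩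
    obtain rfl : j = 0 := by omega
    simpa using hbase0 s
  | succ M ih =>
    intro s
    obtain ⟨X, hX, hle, hXb, hXt⟩ := ih (r (M + 1) s)
    have hexp : ∀ j ≤ M, Real.exp (ε * ∑ i ∈ Finset.Ico j (M + 1), (k i : ℝ)) =
        Real.exp (k M * ε) * Real.exp (ε * ∑ i ∈ Finset.Ico j M, (k i : ℝ)) := by
      intro j hj
      rw [Finset.sum_Ico_succ_top hj, ← Real.exp_add]
      congr 1
      ring
    -- The new step rescales all earlier pieces and appends the excess at a point of net M + 1.
    refine ⟨fun j => if j ≤ M then Real.exp (k M * ε) • X j else A M (r (M + 1) s),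
      fun j => ?_, ?_, fun j hj => ?_, fun j hj => ?_⟩
    · dsimp only
      split_ifs
      · exact (hX j).smul (Real.exp_nonneg _)
      · exact hA _ _
    · refine (hdom M _).trans ?_
      rw [Finset.sum_range_succ, if_neg (by omega)]
      refine add_le_add_left ((smul_matrix_mono (Real.exp_nonneg _) hle).trans_eq ?_) _
      rw [Finset.smul_sum]
      refine Finset.sum_congr rfl fun j hj => ?_
      rw [if_pos (by simp at hj; omega)]
    · dsimp only
      rcases hj.lt_or_eq with hlt | rfl
      · rw [if_pos (by omega), hexp j (by omega), mul_smul]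
        exact smul_matrix_mono (Real.exp_nonneg _) (hXb j (by omega))
      · rw [if_neg (by omega)]
        simpa using hbase M s
    · dsimp only
      rcases Nat.lt_or_ge j M with hlt | hge
      · rw [if_pos (by omega), hexp (j + 1) (by omega), re_trace_smul, mul_assoc]
        exact mul_le_mul_of_nonneg_left (hXt j hlt) (Real.exp_nonneg _)
      · obtain rfl : j = M := by omega
        rw [if_neg (by omega)]
        simpa using htr j (r (j + 1) s)

variable [Fintype Z] [DecidableEq Z] [DecidableEq b]

/-- The reference operator is the sum of the `base j` with weights u j. `hu` makes it dominate every
chain with weights c θ^j, `hmass` bounds its trace by one, and `hM` makes the last net exact, so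
that every output state is reached. -/
theorem mutualInfo_le_of_nets (hε : 0 < ε) (hδ : 0 ≤ δ) (hτ : ∀ s, IsDensity (τ s))
    (hinv : IsPermutationInvariant τ) (hdp : IsOneNeighborDP τ ε δ)
    {P : (Fin n → Z) → ℝ} (hP : P ∈ stdSimplex ℝ (Fin n → Z))
    {r : ℕ → (Fin n → Z) → (Fin n → Z)} {k : ℕ → ℕ} (hr : ∀ j s, typeDist s (r j s) ≤ k j)
    {M : ℕ} (hM : k M = 0) {c θ : ℝ} (hc : 0 < c) (hθ : 0 < θ) (hθ1 : θ ≤ 1) {u : ℕ → ℝ}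
    (hu : ∀ j ≤ M, c * θ ^ j * Real.exp (ε * ∑ i ∈ Finset.Ico j M, (k i : ℝ)) ≤ u j)
    (hmass : u 0 * (Finset.univ.image (r 0)).card +
      ∑ j ∈ Finset.range M, u (j + 1) * ((Finset.univ.image (r (j + 1))).card *
        groupDelta (k j) ε δ) ≤ 1) :
    mutualInfo (cqState P τ) ≤ ((-Real.log c + (1 / θ - 1) * ∑ j ∈ Finset.range M,
      ((j : ℝ) + 1) * (Real.exp (ε * ∑ i ∈ Finset.Ico (j + 1) M, (k i : ℝ)) *
        groupDelta (k j) ε δ) : ℝ) : EReal) := by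
  have hτ0 : ∀ s, (τ s).PosSemidef := fun s => (hτ s).1
  have htr : ∀ s, (τ s).trace.re = 1 := fun s => by rw [(hτ s).2, Complex.one_re]
  have hdom := fun j s => exists_domination hε hδ hτ0 hinv hdp (hr j s)
  choose A hA hAdom hAtr using hdom
  -- The excess A j is needed only at points of net j + 1, hence the shift of the index.
  set base : ℕ → Matrix b b ℂ := fun j =>
    if j = 0 then ∑ y ∈ Finset.univ.image (r 0), τ y
    else ∑ x ∈ Finset.univ.image (r j), A (j - 1) x with hbase
  have hb0 : base 0 = ∑ y ∈ Finset.univ.image (r 0), τ y := if_pos rfl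
  have hbs : ∀ j, base (j + 1) = ∑ x ∈ Finset.univ.image (r (j + 1)), A j x := fun j => by
    rw [hbase]
    simp
  have hbpos : ∀ j, (base j).PosSemidef := by
    rintro (_ | j)
    · rw [hb0]
      exact posSemidef_finset_sum _ fun y _ => hτ0 y
    · rw [hbs]
      exact posSemidef_finset_sum _ fun x _ => hA j x
  have hchain := exists_chain hτ0 hA hAdom hAtr (base := base)
    (fun s => by
      rw [hb0]
      exact Finset.single_le_sum (f := τ) (fun y _ => (hτ0 y).nonneg)
        (Finset.mem_image_of_mem _ (Finset.mem_univ s)))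
    (fun j s => by
      rw [hbs]
      exact Finset.single_le_sum (f := A j) (fun y _ => (hA j y).nonneg)
        (Finset.mem_image_of_mem _ (Finset.mem_univ s))) M
  have hu0 : ∀ j ≤ M, 0 ≤ u j := fun j hj => le_trans (by positivity) (hu j hj)
  set q : Matrix b b ℂ := ∑ j ∈ Finset.range (M + 1), u j • base j with hq
  have hq0 : q.PosSemidef := posSemidef_finset_sum _ fun j hj =>
    (hbpos j).smul (hu0 j (by simp at hj; omega))
  have hqtr : q.trace.re ≤ 1 := by
    refine le_trans ?_ hmass
    rw [hq, re_trace_sum, Finset.sum_range_succ', add_comm]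
    refine add_le_add ?_ (Finset.sum_le_sum fun j hj => ?_)
    · rw [re_trace_smul, hb0, re_trace_sum]
      simp [htr]
    · rw [re_trace_smul, hbs, re_trace_sum]
      refine mul_le_mul_of_nonneg_left ?_ (hu0 _ (by simp at hj; omega))
      refine (Finset.sum_le_sum fun x _ => hAtr j x).trans_eq ?_
      rw [Finset.sum_const, nsmul_eq_mul]
  set K : ℝ := -Real.log c + (1 / θ - 1) * ∑ j ∈ Finset.range M,
      ((j : ℝ) + 1) * (Real.exp (ε * ∑ i ∈ Finset.Ico (j + 1) M, (k i : ℝ)) *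
        groupDelta (k j) ε δ) with hK
  have hbound : ∀ ζ : ℝ, 0 < ζ → ∀ s,
      (τ s * (matLog (τ s) - matLog (q + ζ • (1 : Matrix b b ℂ)))).trace.re ≤ K := by
    intro ζ hζ s
    obtain ⟨X, hX, hle, hXb, hXt⟩ := hchain s
    have hs : τ (r M s) = τ s :=
      (hinv _ _ (letterCount_eq_of_typeDist_eq_zero (Nat.le_zero.mp ((hr M s).trans hM.le)))).symm
    rw [hs] at hle
    refine (relEntropy_chain_le (hτ0 s) M hX hle hc hθ hθ1 hζ (q := q) ?_).trans ?_
    · refine Finset.sum_le_sum fun j hj => ?_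
      have hj : j ≤ M := by simp at hj; omega
      refine (smul_matrix_mono (by positivity) (hXb j hj)).trans ?_
      rw [smul_smul]
      exact smul_matrix_mono_left (hbpos j) (hu j hj)
    · rw [htr, mul_one, hK, Finset.sum_range_succ', Nat.cast_zero, zero_mul, add_zero]
      have hθ2 : 0 ≤ 1 / θ - 1 := sub_nonneg.mpr (one_le_one_div hθ hθ1)
      refine add_le_add le_rfl (mul_le_mul_of_nonneg_left (Finset.sum_le_sum fun j hj => ?_) hθ2)
      rw [Nat.cast_succ]
      exact mul_le_mul_of_nonneg_left (hXt j (Finset.mem_range.mp hj)) (by positivity)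
  have hζ : ∀ ζ : ℝ, 0 < ζ →
      mutualInfo (cqState P τ) ≤ ((K + ζ * Fintype.card b : ℝ) : EReal) := by
    intro ζ hζ
    refine (mutualInfo_cqState_le hP hτ (posDef_add_smul_one hq0 hζ) (hbound ζ hζ)).trans ?_
    rw [EReal.coe_le_coe_iff, Matrix.trace_add, Complex.add_re, re_trace_smul, Matrix.trace_one,
      Complex.natCast_re]
    linarith
  -- The regularisation ζ served only to make the reference operator positive definite.
  have hlim : Filter.Tendsto (fun ζ : ℝ => ((K + ζ * Fintype.card b : ℝ) : EReal))
      (nhdsWithin 0 (Set.Ioi 0)) (nhds (K : EReal)) := by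
    refine (continuous_coe_real_ereal.tendsto K).comp ?_
    have : Filter.Tendsto (fun ζ : ℝ => K + ζ * Fintype.card b) (nhds 0)
        (nhds (K + 0 * Fintype.card b)) := Continuous.tendsto (by fun_prop) 0
    rw [zero_mul, add_zero] at this
    exact this.mono_left nhdsWithin_le_nhds
  exact ge_of_tendsto hlim (by filter_upwards [self_mem_nhdsWithin] with ζ h using hζ ζ h)

end Multiscale

/-! ### Choice of radii and weights -/

section Assembly

theorem sum_Ico_half_pow_le (M : ℕ) : ∑ i ∈ Finset.Ico 1 M, (1 / 2 : ℝ) ^ i ≤ 1 := by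
  have h : ∀ M, ∑ i ∈ Finset.range M, (1 / 2 : ℝ) ^ (i + 1) = 1 - (1 / 2) ^ M := by
    intro M
    induction M with
    | zero => simp
    | succ M ih => rw [Finset.sum_range_succ, ih]; ring
  rw [Finset.sum_Ico_eq_sum_range]
  simp only [add_comm 1]
  rw [h]
  linarith [pow_pos (by norm_num : (0 : ℝ) < 1 / 2) (M - 1)]

theorem sum_succ_mul_half_pow_le (M : ℕ) :
    ∑ j ∈ Finset.range M, ((j : ℝ) + 1) * (1 / 2) ^ j ≤ 4 := by
  have h : ∑ j ∈ Finset.range M, ((j : ℝ) + 1) * (1 / 2) ^ j =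
      4 - (2 * M + 4) * (1 / 2) ^ M := by
    induction M with
    | zero => simp
    | succ M ih =>
      rw [Finset.sum_range_succ, ih]
      push_cast
      ring
  rw [h]
  have : 0 ≤ (2 * (M : ℝ) + 4) * (1 / 2) ^ M := by positivity
  linarith

/-- The ratio of the weights of consecutive nets for types with `D` degrees of freedom. -/
noncomputable def netRatio (D : ℕ) : ℝ := 1 / 40 * (1 / 72) ^ D * (1 / 2) ^ (D + 1)

theorem netRatio_pos (D : ℕ) : 0 < netRatio D := by
  unfold netRatio
  positivity

theorem netRatio_le_one (D : ℕ) : netRatio D ≤ 1 := by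
  unfold netRatio
  have h1 : (1 / 72 : ℝ) ^ D ≤ 1 := pow_le_one₀ (by norm_num) (by norm_num)
  have h2 : (1 / 2 : ℝ) ^ (D + 1) ≤ 1 := pow_le_one₀ (by norm_num) (by norm_num)
  have h3 : (1 / 72 : ℝ) ^ D * (1 / 2) ^ (D + 1) ≤ 1 := mul_le_one₀ h1 (by positivity) h2
  rw [mul_assoc]
  linarith

theorem netRatio_pow_le (D : ℕ) {j : ℕ} (hj : 1 ≤ j) :
    netRatio D ^ j ≤ 1 / 40 * (1 / 72) ^ D * ((1 / 2) ^ (D + 1)) ^ j := by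
  unfold netRatio
  rw [mul_pow]
  refine mul_le_mul_of_nonneg_right ?_ (by positivity)
  refine pow_le_of_le_one (by positivity) ?_ (by omega)
  have h1 : (1 / 72 : ℝ) ^ D ≤ 1 := pow_le_one₀ (by norm_num) (by norm_num)
  linarith

variable {Z b : Type*} [Fintype Z] [DecidableEq Z] [Fintype b] [DecidableEq b] {n : ℕ}
  {τ : (Fin n → Z) → Matrix b b ℂ} {ε δ : ℝ}

/-- The value of c gives the leading term exactly, so the count of the first net must fit without a
constant. All losses go into the ratio θ = `netRatio D`, which multiplies g only. -/
theorem mutualInfo_cqState_le_of_dp (hn : 1 ≤ n) (h1 : 1 / (n : ℝ) ≤ ε) (h2 : ε < 1)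
    (hδ : 0 ≤ δ) {D : ℕ} (hD : 1 ≤ D) (hcard : Fintype.card Z = D + 1)
    (hg : groupDelta ((n * D : ℕ) : ℝ) ε δ ≤ 1) (hτ : ∀ s, IsDensity (τ s))
    (hinv : IsPermutationInvariant τ) (hdp : IsOneNeighborDP τ ε δ)
    {P : (Fin n → Z) → ℝ} (hP : P ∈ stdSimplex ℝ (Fin n → Z)) :
    mutualInfo (cqState P τ) ≤ ((D * Real.log (n * Real.exp 1 * ε) +
      4 * Real.exp D / netRatio D * groupDelta ((n * D : ℕ) : ℝ) ε δ : ℝ) : EReal) := by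
  have hn0 : (0 : ℝ) < n := by exact_mod_cast hn
  have hD0 : (0 : ℝ) < D := by exact_mod_cast hD
  have hε : 0 < ε := (by positivity : (0 : ℝ) < 1 / n).trans_le h1
  have hR : 1 ≤ n * ε := by
    rw [div_le_iff₀ hn0] at h1
    linarith
  set g := groupDelta ((n * D : ℕ) : ℝ) ε δ with hgdef
  have hg0 : 0 ≤ g := groupDelta_nonneg hε hδ _
  obtain ⟨h, hhn, hJ⟩ := exists_radius hn h1 h2
  obtain ⟨z₀⟩ : Nonempty Z := Fintype.card_pos_iff.mp (by omega)
  have hcard' : Fintype.card Z - 1 = D := by omega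
  -- With 36 the finer radii add at most D/36 to the exponent, half of the slack D/18.
  set l : ℕ → ℕ := fun j => ⌊1 / (36 * ε) * (1 / 2) ^ j⌋₊ with hl
  have hl0 : ∀ j, 0 ≤ 1 / (36 * ε) * (1 / 2) ^ j := fun j => by positivity
  have hlle : ∀ j, (l j : ℝ) ≤ 1 / (36 * ε) * (1 / 2) ^ j := fun j => Nat.floor_le (hl0 j)
  have hllt : ∀ j, 1 / (36 * ε) * (1 / 2) ^ j < l j + 1 := fun j => Nat.lt_floor_add_one _
  obtain ⟨r₀, hr₀, hr₀'⟩ := exists_centered_net (n := n) z₀ h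
  have hnet := fun l => exists_net (n := n) z₀ l
  choose r' hr' hr'' using hnet
  rw [hcard'] at hr₀'
  simp only [hcard'] at hr₀ hr' hr''
  set r : ℕ → (Fin n → Z) → (Fin n → Z) := fun j => if j = 0 then r₀ else r' (l j) with hrdef
  set k : ℕ → ℕ := fun j => if j = 0 then D * h else D * l j with hkdef
  have hr : ∀ j s, typeDist s (r j s) ≤ k j := by
    intro j s
    by_cases hj : j = 0
    · simpa [hrdef, hkdef, hj] using hr₀ s
    · simpa [hrdef, hkdef, hj] using hr' (l j) s
  obtain ⟨M', hM'⟩ := exists_pow_lt_of_lt_one (by positivity : 0 < 36 * ε)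
    (by norm_num : (1 / 2 : ℝ) < 1)
  set M := M' + 1 with hMdef
  have hlM : l M = 0 := by
    rw [hl]
    refine Nat.floor_eq_zero.mpr ?_
    rw [hMdef, pow_succ, one_div_mul_eq_div, div_lt_one (by positivity)]
    have : (0 : ℝ) < (1 / 2) ^ M' := by positivity
    linarith
  have hkM : k M = 0 := by
    simp only [hkdef]
    rw [if_neg (Nat.succ_ne_zero _), hlM, mul_zero]
  -- the radii decay geometrically
  have hkn : ∀ j, (k j : ℝ) ≤ (1 / 2) ^ j * (n * D) := by
    intro j
    by_cases hj : j = 0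
    · have : (h : ℝ) ≤ n := by exact_mod_cast hhn
      simp only [hkdef, hj, if_true, pow_zero, one_mul]
      push_cast
      nlinarith
    · simp only [hkdef, hj, if_false]
      push_cast
      have h3 : 1 / (36 * ε) ≤ n := by
        rw [div_le_iff₀ (by positivity)]
        linarith
      have h4 := (hlle j).trans (mul_le_mul_of_nonneg_right h3 (by positivity))
      have := mul_le_mul_of_nonneg_left h4 hD0.le
      linarith
  have hG : ∀ j, groupDelta (k j) ε δ ≤ (1 / 2) ^ j * g := by
    intro j
    have h3 : k j ≤ n * D := by
      have h4 : ((1 : ℝ) / 2) ^ j ≤ 1 := pow_le_one₀ (by norm_num) (by norm_num)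
      have h5 : (k j : ℝ) ≤ n * D :=
        (hkn j).trans (mul_le_of_le_one_left (by positivity) h4)
      exact_mod_cast h5
    have h4 := mul_groupDelta_le hε hδ h3
    rw [← hgdef] at h4
    have h5 := h4.trans (mul_le_mul_of_nonneg_right (hkn j) hg0)
    push_cast at h5
    have h6 : (0 : ℝ) < n * D := by positivity
    refine le_of_mul_le_mul_left (h5.trans_eq ?_) h6
    ring
  have hG1 : ∀ j, groupDelta (k j) ε δ ≤ 1 := fun j => by
    have h4 : ((1 : ℝ) / 2) ^ j ≤ 1 := pow_le_one₀ (by norm_num) (by norm_num)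
    exact (hG j).trans (mul_le_one₀ h4 hg0 hg)
  have hsum1 : ε * ∑ i ∈ Finset.Ico 1 M, (k i : ℝ) ≤ D * (1 / 36) := by
    have h3 : ∑ i ∈ Finset.Ico 1 M, (k i : ℝ) ≤
        ∑ i ∈ Finset.Ico 1 M, D * (1 / (36 * ε)) * (1 / 2) ^ i := by
      refine Finset.sum_le_sum fun i hi => ?_
      have hi : i ≠ 0 := by simp at hi; omega
      simp only [hkdef, hi, if_false]
      push_cast
      rw [mul_assoc]
      exact mul_le_mul_of_nonneg_left (hlle i) hD0.le
    rw [← Finset.mul_sum] at h3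
    have h4 := h3.trans (mul_le_of_le_one_right (by positivity) (sum_Ico_half_pow_le M))
    refine (mul_le_mul_of_nonneg_left h4 hε.le).trans_eq ?_
    field_simp
  have hsum : ∀ j, Real.exp (ε * ∑ i ∈ Finset.Ico (j + 1) M, (k i : ℝ)) ≤
      Real.exp (1 / 36) ^ D := by
    intro j
    rw [← Real.exp_nat_mul]
    refine Real.exp_le_exp.mpr (le_trans (mul_le_mul_of_nonneg_left ?_ hε.le) hsum1)
    refine Finset.sum_le_sum_of_subset_of_nonneg (Finset.Ico_subset_Ico_left (by omega)) ?_
    intros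
    positivity
  have hsum0 : Real.exp (ε * ∑ i ∈ Finset.Ico 0 M, (k i : ℝ)) ≤
      (Real.exp (ε * h) * Real.exp (1 / 36)) ^ D := by
    rw [← Real.exp_add, ← Real.exp_nat_mul]
    refine Real.exp_le_exp.mpr ?_
    rw [Finset.sum_eq_sum_Ico_succ_bot (by omega), mul_add]
    have : (k 0 : ℝ) = D * h := by simp [hkdef]
    rw [this]
    linarith
  -- the weights of the nets
  set c : ℝ := ((n * ε * Real.exp 1) ^ D)⁻¹ with hc
  have hc0 : 0 < c := by positivity
  set J : ℕ → ℕ := fun j => if j = 0 then n / (2 * h + 1) + 1 else n / (l j + 1) + 1 with hJdef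
  have hJ0 : ∀ j, (0 : ℝ) < J j := fun j => by
    simp only [hJdef]
    split_ifs <;> positivity
  have hJcard : ∀ j, ((Finset.univ.image (r j)).card : ℝ) ≤ (J j : ℝ) ^ D := by
    intro j
    by_cases hj : j = 0
    · simp only [hrdef, hJdef, hj, if_true]
      exact_mod_cast hr₀'
    · simp only [hrdef, hJdef, hj, if_false]
      exact_mod_cast hr'' (l j)
  -- Mass 39/40 goes to the first net and at most 1/40 to all the others, spread evenly over the
  -- cell bound J j ^ D.
  set u : ℕ → ℝ := fun j => (if j = 0 then 39 / 40 else 1 / 40 * (1 / 2) ^ j) / (J j : ℝ) ^ D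
    with hudef
  have hu : ∀ j ≤ M, c * netRatio D ^ j * Real.exp (ε * ∑ i ∈ Finset.Ico j M, (k i : ℝ)) ≤ u j := by
    rintro (_ | j) -
    · simp only [hudef, if_true]
      rw [pow_zero, mul_one, le_div_iff₀ (by have := hJ0 0; positivity)]
      have h3 : (J 0 : ℝ) * (Real.exp (ε * h) * Real.exp (1 / 36)) ≤
          (n * ε * Real.exp 1) * Real.exp (-(1 / 36)) := by
        rw [← mul_assoc]
        have := mul_le_mul_of_nonneg_right hJ (Real.exp_nonneg (1 / 36))
        refine this.trans_eq ?_
        rw [mul_assoc, mul_assoc _ (Real.exp 1), ← Real.exp_add, ← Real.exp_add]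
        congr 2
        ring
      -- The unused half of the slack frees the mass 1/40 for the finer nets.
      have h4 : Real.exp (-(1 / 36)) ≤ 39 / 40 := by
        rw [Real.exp_neg, inv_le_comm₀ (Real.exp_pos _) (by norm_num)]
        have := Real.add_one_le_exp (1 / 36 : ℝ)
        linarith
      have h5 : Real.exp (-(1 / 36)) ^ D ≤ 39 / 40 :=
        (pow_le_of_le_one (Real.exp_nonneg _) (h4.trans (by norm_num)) (by omega)).trans h4
      calc c * Real.exp (ε * ∑ i ∈ Finset.Ico 0 M, (k i : ℝ)) * (J 0 : ℝ) ^ D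
          ≤ c * (Real.exp (ε * h) * Real.exp (1 / 36)) ^ D * (J 0 : ℝ) ^ D :=
            mul_le_mul_of_nonneg_right (mul_le_mul_of_nonneg_left hsum0 hc0.le) (by positivity)
        _ = c * ((J 0 : ℝ) * (Real.exp (ε * h) * Real.exp (1 / 36))) ^ D := by ring
        _ ≤ c * ((n * ε * Real.exp 1) * Real.exp (-(1 / 36))) ^ D :=
            mul_le_mul_of_nonneg_left (pow_le_pow_left₀ (by positivity) h3 D) hc0.le
        _ = Real.exp (-(1 / 36)) ^ D := by
            rw [mul_pow, ← mul_assoc, hc, inv_mul_cancel₀ (by positivity), one_mul]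
        _ ≤ 39 / 40 := h5
    · simp only [hudef, Nat.succ_ne_zero, if_false]
      have hJj := hJ0 (j + 1)
      rw [le_div_iff₀ (by positivity)]
      -- The floor gives 36 and the summand 1 in J doubles it, as n ε ≥ 1. The powers of 72 and 2 in
      -- `netRatio` cancel this count and leave (1/2)^(j+1).
      have h3 : (J (j + 1) : ℝ) ≤ 72 * 2 ^ (j + 1) * (n * ε) := by
        have h4 : ((n / (l (j + 1) + 1) : ℕ) : ℝ) ≤ n / (l (j + 1) + 1 : ℝ) := by
          exact_mod_cast Nat.cast_div_le (α := ℝ) (m := n) (n := l (j + 1) + 1)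
        have h5 : (n : ℝ) / (l (j + 1) + 1 : ℝ) ≤ 36 * 2 ^ (j + 1) * (n * ε) := by
          rw [div_le_iff₀ (by positivity)]
          have h6 := mul_le_mul_of_nonneg_left (hllt (j + 1)).le
            (by positivity : 0 ≤ 36 * 2 ^ (j + 1) * (n * ε))
          refine le_trans (le_of_eq ?_) h6
          rw [one_div_pow]
          field_simp
        have h7 : (1 : ℝ) ≤ 2 ^ (j + 1) := one_le_pow₀ (by norm_num)
        simp only [hJdef, Nat.succ_ne_zero, if_false]
        push_cast
        nlinarith
      have h8 : Real.exp (1 / 36) ≤ Real.exp 1 := Real.exp_le_exp.mpr (by norm_num)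
      calc c * netRatio D ^ (j + 1) * Real.exp (ε * ∑ i ∈ Finset.Ico (j + 1) M, (k i : ℝ)) *
            (J (j + 1) : ℝ) ^ D
          ≤ c * (1 / 40 * (1 / 72) ^ D * ((1 / 2) ^ (D + 1)) ^ (j + 1)) * Real.exp 1 ^ D *
            (72 * 2 ^ (j + 1) * (n * ε)) ^ D := by
            have hθ := netRatio_pow_le D (Nat.succ_pos j)
            have h9 := (hsum j).trans (pow_le_pow_left₀ (Real.exp_nonneg _) h8 D)
            have := netRatio_pos D
            gcongr
        _ = (c * (n * ε * Real.exp 1) ^ D) * (1 / 40 * (((1 / 72) ^ D * 72 ^ D) *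
            (((1 / 2) ^ (j + 1) * 2 ^ (j + 1)) ^ D * (1 / 2) ^ (j + 1)))) := by
            simp only [mul_pow, ← pow_mul]
            ring
        _ = 1 / 40 * (1 / 2) ^ (j + 1) := by
            rw [hc, inv_mul_cancel₀ (by positivity), ← mul_pow, ← mul_pow]
            norm_num
  have huc : ∀ j, u j * (Finset.univ.image (r j)).card ≤
      if j = 0 then 39 / 40 else 1 / 40 * (1 / 2) ^ j := by
    intro j
    have hJj := hJ0 j
    simp only [hudef]
    rw [div_mul_eq_mul_div, div_le_iff₀ (by positivity)]
    refine mul_le_mul_of_nonneg_left (hJcard j) ?_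
    split_ifs <;> positivity
  have hmass : u 0 * (Finset.univ.image (r 0)).card + ∑ j ∈ Finset.range M, u (j + 1) *
      ((Finset.univ.image (r (j + 1))).card * groupDelta (k j) ε δ) ≤ 1 := by
    have h3 : ∑ j ∈ Finset.range M, u (j + 1) *
        ((Finset.univ.image (r (j + 1))).card * groupDelta (k j) ε δ) ≤
        ∑ j ∈ Finset.range M, 1 / 40 * (1 / 2 : ℝ) ^ (j + 1) := by
      refine Finset.sum_le_sum fun j _ => ?_
      rw [← mul_assoc]
      have h4 := huc (j + 1)
      rw [if_neg (by omega)] at h4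
      refine (mul_le_mul h4 (hG1 j) (groupDelta_nonneg hε hδ _) (by positivity)).trans_eq ?_
      rw [mul_one]
    have h4 : ∑ j ∈ Finset.range M, (1 / 2 : ℝ) ^ (j + 1) ≤ 1 := by
      have := sum_Ico_half_pow_le (M + 1)
      rw [Finset.sum_Ico_eq_sum_range] at this
      simpa only [add_comm 1, Nat.add_sub_cancel] using this
    rw [← Finset.mul_sum] at h3
    have h5 := huc 0
    rw [if_pos rfl] at h5
    linarith
  refine (mutualInfo_le_of_nets hε hδ hτ hinv hdp hP hr hkM hc0 (netRatio_pos D)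
    (netRatio_le_one D) hu hmass).trans ?_
  rw [EReal.coe_le_coe_iff]
  refine add_le_add (le_of_eq ?_) ?_
  · rw [hc, Real.log_inv, neg_neg, Real.log_pow]
    congr 2
    ring
  · have hθ := netRatio_pos D
    have h3 : ∑ j ∈ Finset.range M, ((j : ℝ) + 1) *
        (Real.exp (ε * ∑ i ∈ Finset.Ico (j + 1) M, (k i : ℝ)) * groupDelta (k j) ε δ) ≤
        ∑ j ∈ Finset.range M, (Real.exp D * g) * (((j : ℝ) + 1) * (1 / 2) ^ j) := by
      refine Finset.sum_le_sum fun j _ => ?_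
      have h4 : Real.exp (1 / 36) ^ D ≤ Real.exp D := by
        rw [← Real.exp_nat_mul]
        exact Real.exp_le_exp.mpr (by linarith)
      have h5 := mul_le_mul ((hsum j).trans h4) (hG j) (groupDelta_nonneg hε hδ _)
        (Real.exp_nonneg _)
      refine (mul_le_mul_of_nonneg_left h5 (by positivity)).trans_eq ?_
      ring
    rw [← Finset.mul_sum] at h3
    have h4 := h3.trans (mul_le_mul_of_nonneg_left (sum_succ_mul_half_pow_le M)
      (mul_nonneg (Real.exp_nonneg D) hg0))
    have h5 : 0 ≤ 1 / netRatio D - 1 := sub_nonneg.mpr (one_le_one_div hθ (netRatio_le_one D))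
    refine (mul_le_mul_of_nonneg_left h4 h5).trans ?_
    have h6 : 0 ≤ Real.exp D * g * 4 := by positivity
    have h7 : 4 * Real.exp D / netRatio D * g = 1 / netRatio D * (Real.exp D * g * 4) := by ring
    rw [h7]
    exact mul_le_mul_of_nonneg_right (by linarith) h6

/-- With at most one sequence, the identity is an exact net with at most one point, and c = θ = 1
makes every term vanish. -/
theorem mutualInfo_cqState_le_zero_of_subsingleton [Subsingleton Z] (hε : 0 < ε) (hδ : 0 ≤ δ)
    (hτ : ∀ s, IsDensity (τ s)) (hinv : IsPermutationInvariant τ) (hdp : IsOneNeighborDP τ ε δ)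
    {P : (Fin n → Z) → ℝ} (hP : P ∈ stdSimplex ℝ (Fin n → Z)) :
    mutualInfo (cqState P τ) ≤ 0 := by
  have h := mutualInfo_le_of_nets (r := fun _ => id) (k := fun _ => 0) (M := 0) (c := 1) (θ := 1)
    (u := fun _ => 1) hε hδ hτ hinv hdp hP (fun _ s => by simp [typeDist]) rfl one_pos one_pos
    le_rfl (fun j hj => by simp) (by
      simp only [Finset.image_id, Finset.range_zero, Finset.sum_empty, add_zero, one_mul]
      exact_mod_cast Finset.card_le_one_of_subsingleton _)
  simpa using h

end Assembly

end QLearn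

theorem mainTheorem6 (N : ℕ) :
    ∃ m : ℝ, 0 < m ∧ m ≤ 1 ∧
      (∀ (n : ℕ) (ε : ℝ), QLearn.stabilityCorrection m n N ε 0 = 0) ∧
      ∀ (Z W B : Type*) [Fintype Z] [DecidableEq Z] [Fintype W] [DecidableEq W]
        [Fintype B] [DecidableEq B] (n d : ℕ) (ε δ : ℝ)
        (ρ : Z → Matrix (Fin d) (Fin d) ℂ) (A : QLearn.LearningAlgorithm Z W B n d)
        (P : (Fin n → Z) → ℝ),
        Fintype.card Z = N → 1 ≤ n → 1 / (n : ℝ) ≤ ε → ε < 1 → 0 ≤ δ →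
        QLearn.groupDelta (n * ((N : ℝ) - 1)) ε δ < 1 →
        (∀ z, QLearn.IsDensity (ρ z)) →
        QLearn.IsPermutationInvariant (A.output ρ) →
        QLearn.IsOneNeighborDP (A.output ρ) ε δ →
        QLearn.IsSupportConsistent (A.output ρ) →
        P ∈ stdSimplex ℝ (Fin n → Z) →
        QLearn.mutualInfo (QLearn.cqState P (A.output ρ)) ≤
          ((((N : ℝ) - 1) * Real.log (n * Real.exp 1 * ε)
            + QLearn.stabilityCorrection m n N ε δ : ℝ) : EReal) := by
  have hθ := QLearn.netRatio_pos (N - 1)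
  -- Chosen so that 2 / m = 4 e^D / `netRatio D` with D = N - 1.
  refine ⟨QLearn.netRatio (N - 1) / (2 * Real.exp (N - 1 : ℕ)), by positivity, ?_, ?_, ?_⟩
  · rw [div_le_one (by positivity)]
    have h1 := QLearn.netRatio_le_one (N - 1)
    have h2 := Real.one_le_exp (Nat.cast_nonneg (α := ℝ) (N - 1))
    linarith
  · intro n ε
    simp [QLearn.stabilityCorrection, QLearn.groupDelta]
  · intro Z W B _ _ _ _ _ _ n d ε δ ρ A P hZ hn h1 h2 hδ hg hρ hinv hdp _ hP
    have hn0 : (0 : ℝ) < n := by exact_mod_cast hn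
    have hε : 0 < ε := (by positivity : (0 : ℝ) < 1 / n).trans_le h1
    have hτ := A.isDensity_output hρ
    -- A probability distribution on sequences exists only if there is a sequence, which also makes
    -- the alphabet nonempty because n ≥ 1.
    obtain ⟨s⟩ : Nonempty (Fin n → Z) := by
      by_contra hempty
      rw [not_nonempty_iff] at hempty
      have := hP.2
      simp at this
    have hN : 1 ≤ N := hZ ▸ Fintype.card_pos_iff.mpr ⟨s ⟨0, hn⟩⟩
    obtain ⟨D, rfl⟩ : ∃ D, N = D + 1 := ⟨N - 1, by omega⟩
    have hcast : (((D + 1 : ℕ) : ℝ) - 1) = D := by push_cast; ring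
    have hcast' : (n : ℝ) * (D : ℝ) = ((n * D : ℕ) : ℝ) := by push_cast; ring
    rw [QLearn.stabilityCorrection]
    rw [hcast, hcast'] at hg ⊢
    have hg0 := QLearn.groupDelta_nonneg hε hδ (n * D)
    -- The multiple of g already covers the whole correction; the logarithmic term enters through
    -- its sign alone.
    have hlog : 0 ≤ Real.log (1 / (1 - QLearn.groupDelta ((n * D : ℕ) : ℝ) ε δ)) :=
      Real.log_nonneg (one_le_one_div (by linarith) (by linarith))
    rcases Nat.eq_zero_or_pos D with rfl | hD
    · have : Subsingleton Z := Fintype.card_le_one_iff_subsingleton.mp hZ.le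
      refine (QLearn.mutualInfo_cqState_le_zero_of_subsingleton hε hδ hτ hinv hdp hP).trans ?_
      rw [← EReal.coe_zero, EReal.coe_le_coe_iff]
      simp only [Nat.cast_zero, zero_mul, zero_add]
      positivity
    · refine (QLearn.mutualInfo_cqState_le_of_dp hn h1 h2 hδ hD hZ hg.le hτ hinv hdp hP).trans ?_
      rw [EReal.coe_le_coe_iff, Nat.add_sub_cancel]
      have e : 2 / (QLearn.netRatio D / (2 * Real.exp D)) = 4 * Real.exp D / QLearn.netRatio D := by
        rw [Nat.add_sub_cancel] at hθ
        field_simp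
        ring
      rw [e]
      linarith
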